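/- Let $n\ge 0$. A Boolean ring is an associative ring, not necessarily with an identity, in which $a^2=a$ for all $a$. A countable (finite or countably infinite) first-order structure is $\omega$-categorical if every countable structure for the same language with the same first-order theory is isomorphic to it. A Boolean ring with $n$ distinguished ideals $(R,J_1,\dots,J_n)$ is regarded as a structure for the language of rings with $n$ unary predicates naming the ideals; an isomorphism $(R,J_1,\dots,J_n)\to(R',J'_1,\dots,J'_n)$ is a ring isomorphism $R\to R'$ carrying $J_i$ onto $J'_i$ for every $i$. For a set $Y$ with a closure operator $\overline{\phantom{A}}$ on its power set $2^Y$ and $\mathcal A\subseteq 2^Y$, let $\langle\mathcal A,{}^-\rangle$ be the smallest Boolean subalgebra of $2^Y$ that contains $\mathcal A$ and is closed under $\overline{\phantom{A}}$. For a poset $S$, the closure of $A\subseteq S$ is the lower subset $\{p\in S\mid p\le a\text{ for some }a\in A\}$. Consider tuples $[S,M,F,g,Q_1,\dots,Q_n]$ where $S$ is a finite poset; $M,Q_1,\dots,Q_n$ are lower subsets of $S$; $F$ is a set of minimal elements of $M$; $g\colon S\to\mathbb N=\{0,1,2,\dots\}$ satisfies $g(s)>0$ for all $s\in F$; and $\langle\{Q_1,\dots,Q_n\},{}^-\rangle=2^S$.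 Two such tuples $[S,M,F,g,Q_1,\dots,Q_n]$ and $[S',M',F',g',Q'_1,\dots,Q'_n]$ are isomorphic if there is an order isomorphism $\theta\colon S\to S'$ with $\theta(M)=M'$, $\theta(F)=F'$, $\theta(Q_i)=Q'_i$ for all $i$, and $g'(\theta(s))=g(s)$ for all $s\in S$. **Theorem.** There is a natural bijection between the isomorphism classes of countable $\omega$-categorical Boolean rings with $n$ distinguished ideals and the isomorphism classes of such tuples. Explicitly, let $X$ be the Stone space of $R$, identify $R$ with the ring of compact open subsets of $X$, and let $C_i=X\setminus\bigcup_{A\in J_i}A$ be the closed set corresponding to $J_i$. The bijection sends the class of $(R,J_1,\dots,J_n)$ to the class of $[S,M,F,g,Q_1,\dots,Q_n]$, where - $S$ is the set of atoms of $\langle\{C_1,\dots,C_n\},{}^-\rangle\subseteq 2^X$ (with topological closure), ordered by $A\le B$ iff $A\subseteq\overline B$; - $M=\{A\in S\mid\overline A\text{ is compact}\}$ and $F=\{A\in S\mid A\text{ is finite}\}$; - $g(A)$ is the (finite) number of isolated points of the subspace $A$, and $Q_i=\{A\in S\mid A\subseteq C_i\}$. -/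

import Mathlib

universe u v

namespace BoolIdeals

open FirstOrder

/-! ### Boolean rings with distinguished ideals, and countable categoricity -/

/-- A Boolean ring (an associative ring, not necessarily with an identity, all of whose elements
are idempotent) together with an `n`-tuple of distinguished ideals. -/
structure IdealSystem (n : ℕ) where
  carrier : Type u
  [ring : NonUnitalRing carrier]
  idem : ∀ a : carrier, a * a = a
  J : Fin n → TwoSidedIdeal carrier

attribute [instance] IdealSystem.ring

/-- Two systems are isomorphic if some ring isomorphism carries the `i`-th distinguished ideal of
the first onto the `i`-th distinguished ideal of the second, for every `i`. -/
def IdealSystem.Iso {n : ℕ} (A B : IdealSystem.{u} n) : Prop :=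
  ∃ φ : A.carrier ≃+* B.carrier, ∀ i a, a ∈ A.J i ↔ φ a ∈ B.J i

/-- The function symbols of the language of rings without identity. -/
inductive RingFun : ℕ → Type
  | zero : RingFun 0
  | add : RingFun 2
  | mul : RingFun 2

/-- The relation symbols: one unary predicate for each distinguished ideal. -/
inductive IdealRel (n : ℕ) : ℕ → Type
  | ideal (i : Fin n) : IdealRel n 1

/-- The first-order language of rings (without identity) with `n` distinguished ideals. -/
def idealLang (n : ℕ) : FirstOrder.Language.{0, 0} where
  Functions := RingFun
  Relations := IdealRel n

instance IdealSystem.instStructure {n : ℕ} (A : IdealSystem.{u} n) :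
    (idealLang n).Structure A.carrier where
  funMap {k} (f : RingFun k) := match k, f with
    | _, .zero => fun _ => 0
    | _, .add => fun x => x 0 + x 1
    | _, .mul => fun x => x 0 * x 1
  RelMap {k} (r : IdealRel n k) := match k, r with
    | _, .ideal i => fun x => x 0 ∈ A.J i

/-- A countable structure is `ω`-categorical if it is determined up to isomorphism, within the
class of countable (finite or countably infinite) structures for its language, by its first-order
properties. -/
def OmegaCategorical (L : FirstOrder.Language.{0, 0}) (M : Type u) [L.Structure M] : Prop :=
  Countable M ∧ ∀ (N : Type u) [L.Structure N] [Countable N],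
    L.ElementarilyEquivalent M N → Nonempty (M ≃[L] N)

/-- The countable `ω`-categorical Boolean rings with `n` distinguished ideals. -/
def OmegaCatSystem (n : ℕ) : Type (u + 1) :=
  {A : IdealSystem.{u} n // OmegaCategorical (idealLang n) A.carrier}

instance OmegaCatSystem.instSetoid (n : ℕ) : Setoid (OmegaCatSystem.{u} n) where
  r A B := A.1.Iso B.1
  iseqv :=
    { refl := fun A => ⟨RingEquiv.refl _, fun _ _ => Iff.rfl⟩
      symm := fun {A B} ⟨φ, h⟩ => ⟨φ.symm, fun i b => by
        rw [h, RingEquiv.apply_symm_apply]⟩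
      trans := fun {A B C} ⟨φ, h⟩ ⟨ψ, k⟩ => ⟨φ.trans ψ, fun i a => (h i a).trans (k i (φ a))⟩ }

/-! ### The Stone space -/

/-- The Stone space of a Boolean ring: its nonzero homomorphisms to the two-element field
(equivalently, its prime ideals). -/
def StoneSpace (R : Type u) [NonUnitalRing R] : Type u := {x : R →ₙ+* ZMod 2 // x ≠ 0}

/-- The set of points of the Stone space at which the ring element `a` takes the value `1`. -/
def StoneSpace.basic {R : Type u} [NonUnitalRing R] (a : R) : Set (StoneSpace R) :=
  {x | x.1 a = 1}

instance StoneSpace.instTopologicalSpace (R : Type u) [NonUnitalRing R] :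
    TopologicalSpace (StoneSpace R) :=
  TopologicalSpace.generateFrom (Set.range StoneSpace.basic)

/-- The closed set corresponding to an ideal `J`: the complement of the union of the compact open
sets that belong to `J`. -/
def StoneSpace.zeroLocus {R : Type u} [NonUnitalRing R] (J : TwoSidedIdeal R) :
    Set (StoneSpace R) :=
  {x | ∀ a ∈ J, x.1 a = 0}

/-! ### Closure subalgebras of power sets -/

/-- For an operator `cl` on the subsets of `X`, the smallest Boolean subalgebra of `2^X` which
contains `G` and is closed under `cl`. It always contains `X` itself. -/
def closureAlg {X : Type u} (cl : Set X → Set X) (G : Set (Set X)) : BooleanSubalgebra (Set X) :=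
  sInf {B | G ⊆ B ∧ ∀ s ∈ B, cl s ∈ B}

/-- The closure subalgebra of `2^X`, for `X` the Stone space of the ring of the system, generated
by the closed sets that correspond to the distinguished ideals. -/
def IdealSystem.stoneAlg {n : ℕ} (A : IdealSystem.{u} n) :
    BooleanSubalgebra (Set (StoneSpace A.carrier)) :=
  closureAlg closure (Set.range fun i => StoneSpace.zeroLocus (A.J i))

/-! ### The tuples `[S, M, F, g, Q₁, …, Qₙ]` -/

/-- Tuples `[S, M, F, g, Q₁, …, Qₙ]`: a finite poset `S`, lower subsets `M, Q₁, …, Qₙ` of `S`, a set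
`F` of minimal elements of `M`, and `g : S → ℕ` positive on `F`, such that `Q₁, …, Qₙ` generate the
closure algebra `2^S`, in which the closure of a subset is the lower set that it generates. -/
structure PosetTuple (n : ℕ) where
  S : Type v
  [order : PartialOrder S]
  [finite : Finite S]
  M : Set S
  F : Set S
  g : S → ℕ
  Q : Fin n → Set S
  lower_M : IsLowerSet M
  lower_Q : ∀ i, IsLowerSet (Q i)
  F_sub : F ⊆ {s | Minimal (· ∈ M) s}
  g_pos : ∀ s ∈ F, 0 < g s
  generates : closureAlg (fun s => (lowerClosure s : Set S)) (Set.range Q) = ⊤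

attribute [instance] PosetTuple.order PosetTuple.finite

/-- Isomorphism of tuples. -/
def PosetTuple.Iso {n : ℕ} (T U : PosetTuple.{v} n) : Prop :=
  ∃ θ : T.S ≃o U.S, (∀ s, s ∈ T.M ↔ θ s ∈ U.M) ∧ (∀ s, s ∈ T.F ↔ θ s ∈ U.F) ∧
    (∀ i s, s ∈ T.Q i ↔ θ s ∈ U.Q i) ∧ ∀ s, U.g (θ s) = T.g s

instance PosetTuple.instSetoid (n : ℕ) : Setoid (PosetTuple.{v} n) where
  r := PosetTuple.Iso
  iseqv :=
    { refl := fun T => ⟨OrderIso.refl _, fun _ => Iff.rfl, fun _ => Iff.rfl,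
        fun _ _ => Iff.rfl, fun _ => rfl⟩
      symm := fun {T U} ⟨θ, hM, hF, hQ, hg⟩ => ⟨θ.symm,
        fun s => by rw [hM, OrderIso.apply_symm_apply],
        fun s => by rw [hF, OrderIso.apply_symm_apply],
        fun i s => by rw [hQ, OrderIso.apply_symm_apply],
        fun s => by rw [← hg, OrderIso.apply_symm_apply]⟩
      trans := fun {T U V} ⟨θ, hM, hF, hQ, hg⟩ ⟨η, kM, kF, kQ, kg⟩ => ⟨θ.trans η,
        fun s => (hM s).trans (kM (θ s)), fun s => (hF s).trans (kF (θ s)),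
        fun i s => (hQ i s).trans (kQ i (θ s)), fun s => (kg (θ s)).trans (hg s)⟩ }

/-! ### The correspondence -/

/-- The tuple `T` is (up to the labelling `X : S ≃ atoms` of the atoms by the elements of `S`) the
tuple attached to the system `A`: the elements of `S` are the atoms of the closure algebra generated
by the closed sets `C₁, …, Cₙ` attached to the distinguished ideals, with `s ≤ t` if and only if
`X s` lies in the closure of `X t`; `M` consists of the atoms with compact closure; `F` of the finite
atoms; `g` counts the isolated points of an atom; and `Q i` consists of the atoms inside `C i`. -/
def IsTupleOf {n : ℕ} (A : IdealSystem.{u} n) (T : PosetTuple.{v} n) : Prop :=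
  ∃ e : T.S ≃ {B : A.stoneAlg // IsAtom B},
    let X : T.S → Set (StoneSpace A.carrier) := fun s => ((e s).1 : Set (StoneSpace A.carrier))
    (∀ s t, s ≤ t ↔ X s ⊆ closure (X t)) ∧
    (∀ s, s ∈ T.M ↔ IsCompact (closure (X s))) ∧
    (∀ s, s ∈ T.F ↔ (X s).Finite) ∧
    (∀ s, (X s \ derivedSet (X s)).encard = T.g s) ∧
    (∀ i s, s ∈ T.Q i ↔ X s ⊆ StoneSpace.zeroLocus (A.J i))

end BoolIdeals

/-!
The bijection rests on a description of the countable `ω`-categorical systems by means of their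
Stone spaces: a countable system is `ω`-categorical if and only if its Stone space carries a
*stratification* by a finite poset `S` (`IsStratification`, `IsStratifiedBy`), that is, a
surjection `π` onto `S` such that the closure of each fibre `π⁻¹(s)` is the union of the fibres
below `s`, every fibre has only finitely many isolated points, and the closed sets of the ideals
are unions of fibres.

* *From categoricity to a stratification.* By the theorem of Ryll-Nardzewski, proved here by
  omitting a type in a generic model, a countable `ω`-categorical structure has finitely many
  types in each number of variables, and tuples of the same type are conjugate under an
  automorphism (`OmegaCategorical.finitelyManyTypes`, `FinitelyManyTypes.exists_equiv`).
  Automorphisms of the ring that preserve the ideals act on the Stone space and preserve each set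
  of the closure algebra. A closed set is determined by the ring elements whose compact open sets
  are disjoint from it, so that the closure algebra has only finitely many closed members; hence
  it has finitely many atoms, which are the strata. An atom has finitely many isolated points,
  because the number of them in a compact open set is an invariant of automorphisms
  (`OmegaCategorical.exists_isStratifiedBy`).

* *Uniqueness and categoricity.* Let two spaces with bases of compact open sets be stratified by
  the same poset with the same `M`, `F` and `g`. Call a clopen set in one of them and one in the
  other equivalent if they contain equally many isolated points of each stratum and accumulation
  points of the same strata, and if the same sets of accumulation points in them are compact
  (`SameInvariants`). Any splitting of the first by a compact open set is then matched by such a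
  splitting of the second (`SameInvariants.exists_extension`). A back-and-forth argument makes the
  rings isomorphic over any two tuples of elements whose cells have the same invariants
  (`IsStratifiedBy.exists_iso`). With empty tuples this shows that the invariants determine the
  system; and since tuples of a given length have finitely many invariants, they form finitely
  many orbits, whence the system is `ω`-categorical (`IsStratifiedBy.omegaCategorical`).

* *The invariants.* In a stratified Stone space the closure algebra consists of the unions of
  strata, because the sets `Q i` generate `2^S`. So the strata are its atoms, and the tuple of a
  stratified system is the stratifying tuple (`IsStratifiedBy.isTupleOf`).

* *Existence.* Given a tuple, a space with the prescribed stratification is built from monotone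
  sequences in `S`, decorated with bits, each of which belongs to the stratum of its eventual
  value (`modelSet`, `isStratification_limitStratum`). The ring of its compact open sets has it as
  its Stone space (`exists_homeomorph_stoneSpace`).
-/

namespace BoolIdeals

open FirstOrder Topology TopologicalSpace

/-! ### Back and forth -/

/-- The abstract back-and-forth argument: a property of finite partial matchings which implies that
they are injective, and which is preserved by suitable extensions to any further element on either
side, holds of finite pieces of some bijection. -/
theorem exists_equiv_of_backAndForth {A B : Type*} [Countable A] [Countable B]
    (P : List (A × B) → Prop)
    (inj : ∀ l, P l → ∀ p ∈ l, ∀ q ∈ l, p.1 = q.1 ↔ p.2 = q.2)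
    (forth : ∀ l a, P l → ∃ b, P ((a, b) :: l))
    (back : ∀ l b, P l → ∃ a, P ((a, b) :: l))
    (l₀ : List (A × B)) (h₀ : P l₀) :
    ∃ f : A ≃ B, ∀ s : Finset A, ∃ l, P l ∧ l₀ ⊆ l ∧ ∀ a ∈ s, (a, f a) ∈ l := by
  classical
  let _ : Preorder {l // P l} :=
    { le := fun l m => l.1 ⊆ m.1
      le_refl := fun l => List.Subset.refl _
      le_trans := fun _ _ _ h k => List.Subset.trans h k }
  let _ : Encodable (A ⊕ B) := Encodable.ofCountable _
  let D : A ⊕ B → Order.Cofinal {l // P l} := Sum.elim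
    (fun a =>
      { carrier := {l | ∃ b, (a, b) ∈ l.1}
        isCofinal := fun l => by
          obtain ⟨b, hb⟩ := forth l.1 a l.2
          exact ⟨⟨_, hb⟩, ⟨b, List.mem_cons_self⟩, List.subset_cons_self _ _⟩ })
    (fun b =>
      { carrier := {l | ∃ a, (a, b) ∈ l.1}
        isCofinal := fun l => by
          obtain ⟨a, ha⟩ := back l.1 b l.2
          exact ⟨⟨_, ha⟩, ⟨a, List.mem_cons_self⟩, List.subset_cons_self _ _⟩ })
  let I := Order.idealOfCofinals ⟨l₀, h₀⟩ D
  have hI₀ : ⟨l₀, h₀⟩ ∈ I := Order.mem_idealOfCofinals _ _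
  have hA : ∀ a, ∃ b, ∃ l ∈ I, (a, b) ∈ l.1 := fun a => by
    obtain ⟨l, ⟨b, hb⟩, hl⟩ := Order.cofinal_meets_idealOfCofinals ⟨l₀, h₀⟩ D (Sum.inl a)
    exact ⟨b, l, hl, hb⟩
  have hB : ∀ b, ∃ a, ∃ l ∈ I, (a, b) ∈ l.1 := fun b => by
    obtain ⟨l, ⟨a, ha⟩, hl⟩ := Order.cofinal_meets_idealOfCofinals ⟨l₀, h₀⟩ D (Sum.inr b)
    exact ⟨a, l, hl, ha⟩
  choose f hf using hA
  choose g hg using hB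
  have key : ∀ a b a' b', (∃ l ∈ I, (a, b) ∈ l.1) → (∃ l ∈ I, (a', b') ∈ l.1) →
      (a = a' ↔ b = b') := by
    rintro a b a' b' ⟨l, hl, h⟩ ⟨m, hm, k⟩
    obtain ⟨t, -, hlt, hmt⟩ := I.directed l hl m hm
    exact inj t.1 t.2 _ (hlt h) _ (hmt k)
  refine ⟨⟨f, g, fun a => ?_, fun b => ?_⟩, fun s => ?_⟩
  · exact (key _ _ _ _ (hg (f a)) (hf a)).2 rfl
  · exact (key _ _ _ _ (hf (g b)) (hg b)).1 rfl
  · suffices ∃ l ∈ I, l₀ ⊆ l.1 ∧ ∀ a ∈ s, (a, f a) ∈ l.1 by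
      obtain ⟨l, -, h, k⟩ := this
      exact ⟨l.1, l.2, h, k⟩
    induction s using Finset.induction_on with
    | empty => exact ⟨_, hI₀, List.Subset.refl l₀, by simp⟩
    | insert a s _ ih =>
      obtain ⟨l, hl, h, k⟩ := ih
      obtain ⟨m, hm, hm'⟩ := hf a
      obtain ⟨t, ht, hlt, hmt⟩ := I.directed l hl m hm
      refine ⟨t, ht, List.Subset.trans h hlt, fun b hb => ?_⟩
      rcases Finset.mem_insert.1 hb with rfl | hb
      · exact hmt hm'
      · exact hlt (k b hb)

/-! ### Compactness and generic models -/

section ModelTheory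

variable {L : FirstOrder.Language.{0, 0}}

open FirstOrder.Language

/-- Compactness, for a directed family of conditions on tuples of elements of `A`. -/
theorem exists_realize_of_directed {A : Type*} [L.Structure A] [Nonempty A] {α : Type} {J : Type*}
    [Nonempty J]
    (C : J → Set (α → A)) (hne : ∀ j, (C j).Nonempty) (hdir : Directed (· ⊇ ·) C) :
    ∃ (M : Type) (_ : L.Structure M) (w : α → M), Nonempty M ∧ (L.ElementarilyEquivalent A M) ∧
      ∀ φ : L.Formula α, (∃ j, ∀ v ∈ C j, φ.Realize v) → φ.Realize w := by
  let T : J → L[[α]].Theory := fun j => {σ | ∀ v ∈ C j, (Formula.equivSentence.symm σ).Realize v}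
  have hT : Directed (· ⊆ ·) T := fun i j => by
    obtain ⟨k, hi, hj⟩ := hdir i j
    exact ⟨k, fun σ h v hv => h v (hi hv), fun σ h v hv => h v (hj hv)⟩
  have hsat : Theory.IsSatisfiable (⋃ j, T j) := by
    rw [Theory.isSatisfiable_directed_union_iff hT]
    intro j
    obtain ⟨v, hv⟩ := hne j
    let _ := constantsOn.structure v
    have : A ⊨ T j := ⟨fun σ hσ => (Formula.realize_equivSentence_symm A σ v).1 (hσ v hv)⟩
    exact Theory.Model.isSatisfiable A
  obtain ⟨M⟩ := hsat
  let _ : L.Structure M := (L.lhomWithConstants α).reduct M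
  have key : ∀ φ : L.Formula α, (∃ j, ∀ v ∈ C j, φ.Realize v) →
      φ.Realize (fun a => (L.con a : M)) := by
    rintro φ ⟨j, h⟩
    rw [← Formula.realize_equivSentence M φ]
    refine Theory.realize_sentence_of_mem (⋃ j, T j) (Set.mem_iUnion.2 ⟨j, fun v hv => ?_⟩)
    rw [_root_.Equiv.symm_apply_apply]
    exact h v hv
  refine ⟨M, inferInstance, fun a => (L.con a : M), inferInstance, ?_, key⟩
  have hs : ∀ σ : L.Sentence, A ⊨ σ → M ⊨ σ := fun σ hσ => by
    obtain ⟨j⟩ := ‹Nonempty J›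
    have := key (Formula.relabel Empty.elim σ) ⟨j, fun v _ => by
      rw [Formula.realize_relabel, Unique.eq_default (v ∘ Empty.elim)]
      exact hσ⟩
    rw [Formula.realize_relabel, Unique.eq_default (_ ∘ Empty.elim)] at this
    exact this
  rw [elementarilyEquivalent_iff]
  refine fun σ => ⟨hs σ, fun h => ?_⟩
  by_contra hn
  exact (Sentence.realize_not M).1 (hs σ.not ((Sentence.realize_not A).2 hn)) h

theorem exists_bound_freeVar {M : Type*} [L.Structure M] (φ : L.Formula ℕ) :
    ∃ N, ∀ v w : ℕ → M, (∀ i < N, v i = w i) → (φ.Realize v ↔ φ.Realize w) := by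
  classical
  refine ⟨(BoundedFormula.freeVarFinset φ).sup id + 1, fun v w h => ?_⟩
  have : ∀ u : ℕ → M, (BoundedFormula.restrictFreeVar φ id).Realize (fun x => u x) default ↔
      φ.Realize u := fun u => BoundedFormula.realize_restrictFreeVar _ (fun _ => rfl)
  rw [← this, ← this]
  have : (fun x : BoundedFormula.freeVarFinset φ => v x) =
      fun x : BoundedFormula.freeVarFinset φ => w x := funext fun x =>
    h _ (Nat.lt_succ_of_le (Finset.le_sup (f := id) x.2))
  rw [this]

/-- **Tarski–Vaught** for the range of a sequence of elements. -/
theorem exists_elementary_range {M : Type} [L.Structure M] (w : ℕ → M)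
    (h : ∀ θ : L.Formula (ℕ ⊕ Unit), (∃ a, θ.Realize (Sum.elim w fun _ => a)) →
      ∃ j, θ.Realize (Sum.elim w fun _ => w j)) :
    ∃ S : L.ElementarySubstructure M, (S : Set M) = Set.range w := by
  let S : L.Substructure M :=
    { carrier := Set.range w
      fun_mem := fun {k} f x hx => by
        choose i hi using hx
        obtain ⟨j, hj⟩ := h ((Term.func f fun m => Term.var (Sum.inl (i m)) :
          L.Term (ℕ ⊕ Unit)).equal (Term.var (Sum.inr ()))) ⟨Structure.funMap f x, by
            simp [hi]⟩
        refine ⟨j, ?_⟩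
        simpa [hi] using hj.symm }
  refine ⟨S.toElementarySubstructure fun k φ x a hφ => ?_, rfl⟩
  have hx : ∀ m, ∃ j, w j = x m := fun m => (x m).2
  choose i hi using hx
  have conv : ∀ b, (Formula.relabel (Sum.elim Empty.elim
      (Fin.snoc (α := fun _ => ℕ ⊕ Unit) (fun m => Sum.inl (i m)) (Sum.inr ())))
        φ.toFormula).Realize (Sum.elim w fun _ => b) ↔
      φ.Realize default (Fin.snoc ((↑) ∘ x) b : _ → M) := fun b => by
    rw [Formula.realize_relabel, BoundedFormula.realize_toFormula]
    have e₁ : (((Sum.elim w fun _ => b) ∘ Sum.elim Empty.elim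
      (Fin.snoc (α := fun _ => ℕ ⊕ Unit) (fun m => Sum.inl (i m)) (Sum.inr ()))) ∘ Sum.inl) =
        default := Subsingleton.elim _ _
    have e₂ : (((Sum.elim w fun _ => b) ∘ Sum.elim Empty.elim
      (Fin.snoc (α := fun _ => ℕ ⊕ Unit) (fun m => Sum.inl (i m)) (Sum.inr ()))) ∘ Sum.inr) =
        (Fin.snoc ((↑) ∘ x) b : Fin (k + 1) → M) := by
      funext m
      refine Fin.lastCases ?_ (fun m => ?_) m <;> simp [hi]
    rw [e₁, e₂]
  obtain ⟨j, hj⟩ := h _ ⟨a, (conv a).2 hφ⟩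
  exact ⟨⟨w j, j, rfl⟩, (conv _).1 hj⟩

/-- Generic models: given countably many requirements, each of which can be met by refining any
formula that is satisfied in `A`, some countable structure elementarily equivalent to `A` has an
enumeration which meets all the requirements. -/
theorem exists_generic [Countable L.Symbols] {A : Type*} [L.Structure A] [Nonempty A] {ι : Type*}
    [Countable ι]
    (D : ι → Set (L.Formula ℕ))
    (hD : ∀ i (φ : L.Formula ℕ), (∃ v : ℕ → A, φ.Realize v) →
      ∃ ψ ∈ D i, ∃ v : ℕ → A, φ.Realize v ∧ ψ.Realize v) :
    ∃ (N : Type) (_ : L.Structure N) (w : ℕ → N), Function.Surjective w ∧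
      L.ElementarilyEquivalent A N ∧ ∀ i, ∃ ψ ∈ D i, ψ.Realize w := by
  let H : L.Formula (ℕ ⊕ Unit) → Set (L.Formula ℕ) := fun θ =>
    {ψ | ψ = (θ.iExs Unit).not ∨ ∃ j, ψ = θ.relabel (Sum.elim id fun _ => j)}
  have hH : ∀ θ (φ : L.Formula ℕ), (∃ v : ℕ → A, φ.Realize v) →
      ∃ ψ ∈ H θ, ∃ v : ℕ → A, φ.Realize v ∧ ψ.Realize v := by
    rintro θ φ ⟨v, hv⟩
    by_cases h : (θ.iExs Unit).Realize v
    · rw [Formula.realize_iExs] at h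
      obtain ⟨a, ha⟩ := h
      -- the witness is named by a variable that occurs neither in `φ` nor in `θ`
      obtain ⟨N₁, h₁⟩ := exists_bound_freeVar (M := A) φ
      obtain ⟨N₂, h₂⟩ := exists_bound_freeVar (M := A)
        (θ.relabel (Sum.elim Nat.succ fun _ => 0))
      refine ⟨_, Or.inr ⟨N₁ + N₂, rfl⟩, Function.update v (N₁ + N₂) (a ()), ?_, ?_⟩
      · refine (h₁ _ _ fun i hi => ?_).1 hv
        rw [Function.update_of_ne (by omega)]
      · have := (h₂ (fun m => Nat.casesOn m (a ()) v)
          (fun m => Nat.casesOn m (a ()) (Function.update v (N₁ + N₂) (a ()))) fun i hi => by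
            cases i with
            | zero => rfl
            | succ i =>
              have hi' : i ≠ N₁ + N₂ := by omega
              exact (Function.update_of_ne hi' _ _).symm).1 (by
            rw [Formula.realize_relabel]
            convert ha using 1
            funext x
            rcases x with x | x <;> rfl)
        rw [Formula.realize_relabel] at this ⊢
        convert this using 1
        funext x
        rcases x with x | x
        · rfl
        · simp
    · exact ⟨_, Or.inl rfl, v, hv, Formula.realize_not.2 h⟩
  -- besides the given requirements, the enumeration has to contain witnesses for the existential
  -- formulas that it satisfies
  let E : ι ⊕ L.Formula (ℕ ⊕ Unit) → Set (L.Formula ℕ) := Sum.elim D H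
  let Pre := {φ : L.Formula ℕ // ∃ v : ℕ → A, φ.Realize v}
  let _ : Preorder Pre :=
    { le := fun φ ψ => ∀ v : ℕ → A, ψ.1.Realize v → φ.1.Realize v
      le_refl := fun φ v h => h
      le_trans := fun _ _ _ h k v hv => h v (k v hv) }
  let _ : Encodable (ι ⊕ L.Formula (ℕ ⊕ Unit)) := Encodable.ofCountable _
  let 𝒟 : ι ⊕ L.Formula (ℕ ⊕ Unit) → Order.Cofinal Pre := fun i =>
    { carrier := {φ | ∃ ψ ∈ E i, ∀ v : ℕ → A, φ.1.Realize v → ψ.Realize v}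
      isCofinal := fun φ => by
        have : ∃ ψ ∈ E i, ∃ v : ℕ → A, φ.1.Realize v ∧ ψ.Realize v := by
          rcases i with i | θ
          exacts [hD i φ.1 φ.2, hH θ φ.1 φ.2]
        obtain ⟨ψ, hψ, v, h₁, h₂⟩ := this
        exact ⟨⟨φ.1 ⊓ ψ, v, Formula.realize_inf.2 ⟨h₁, h₂⟩⟩,
          ⟨ψ, hψ, fun v hv => (Formula.realize_inf.1 hv).2⟩,
          fun v hv => (Formula.realize_inf.1 hv).1⟩ }
  let φ₀ : Pre := ⟨⊤, fun _ => Classical.arbitrary A, Formula.realize_top.2 trivial⟩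
  let I := Order.idealOfCofinals φ₀ 𝒟
  have : Nonempty I := ⟨⟨φ₀, Order.mem_idealOfCofinals _ _⟩⟩
  obtain ⟨M, _, w, -, hAM, hw⟩ := exists_realize_of_directed (L := L) (A := A) (J := I)
    (fun φ => {v : ℕ → A | φ.1.1.Realize v}) (fun φ => φ.1.2) (fun φ ψ => by
      obtain ⟨χ, hχ, h₁, h₂⟩ := I.directed φ.1 φ.2 ψ.1 ψ.2
      exact ⟨⟨χ, hχ⟩, fun v hv => h₁ v hv, fun v hv => h₂ v hv⟩)
  have hE : ∀ i, ∃ ψ ∈ E i, ψ.Realize w := fun i => by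
    obtain ⟨φ, ⟨ψ, hψ, h⟩, hφ⟩ := Order.cofinal_meets_idealOfCofinals φ₀ 𝒟 i
    exact ⟨ψ, hψ, hw ψ ⟨⟨φ, hφ⟩, h⟩⟩
  obtain ⟨S, hS⟩ := exists_elementary_range w fun θ hθ => by
    obtain ⟨a, ha⟩ := hθ
    obtain ⟨ψ, rfl | ⟨j, rfl⟩, h⟩ := hE (Sum.inr θ)
    · exact absurd (Formula.realize_iExs.2 ⟨fun _ => a, ha⟩) (Formula.realize_not.1 h)
    · refine ⟨j, ?_⟩
      rw [Formula.realize_relabel] at h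
      convert h using 1
      funext x
      rcases x with x | x <;> rfl
  have hmem : ∀ j, w j ∈ S := fun j => by
    rw [← SetLike.mem_coe, hS]; exact ⟨j, rfl⟩
  refine ⟨S, inferInstance, fun j => ⟨w j, hmem j⟩, fun x => ?_, ?_, fun i => ?_⟩
  · have : (x : M) ∈ (S : Set M) := x.2
    rw [hS] at this
    obtain ⟨j, hj⟩ := this
    exact ⟨j, Subtype.ext hj⟩
  · exact hAM.trans S.elementarilyEquivalent.symm
  · obtain ⟨ψ, hψ, h⟩ := hE (Sum.inl i)
    exact ⟨ψ, hψ, (S.subtype.map_formula ψ _).1 h⟩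

end ModelTheory

/-! ### The Ryll-Nardzewski theorem -/

section RyllNardzewski

variable {L : FirstOrder.Language.{0, 0}}

open FirstOrder.Language

/-- The formula `θ` isolates a complete type of the structure `A`: it decides every formula. -/
def Isolates (A : Type*) [L.Structure A] {α : Type} (θ : L.Formula α) : Prop :=
  ∀ φ : L.Formula α, (∀ v : α → A, θ.Realize v → φ.Realize v) ∨
    ∀ v : α → A, θ.Realize v → ¬ φ.Realize v

/-- For each `k`, the `k`-tuples of elements of `A` are covered by finitely many formulas, each of
which isolates a complete type. -/
def FinitelyManyTypes (L : FirstOrder.Language.{0, 0}) (A : Type*) [L.Structure A] : Prop :=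
  ∀ k : ℕ, ∃ Θ : Set (L.Formula (Fin k)), Θ.Finite ∧ (∀ θ ∈ Θ, Isolates A θ) ∧
    ∀ v : Fin k → A, ∃ θ ∈ Θ, θ.Realize v

/-- The tuples `v` and `w` satisfy the same formulas. -/
def SameType (L : FirstOrder.Language.{0, 0}) {A B : Type*} [L.Structure A] [L.Structure B]
    {α : Type} (v : α → A) (w : α → B) : Prop :=
  ∀ φ : L.Formula α, φ.Realize v ↔ φ.Realize w

theorem forall_realize_of_elementarilyEquivalent {A B : Type*} [L.Structure A] [L.Structure B]
    (h : L.ElementarilyEquivalent A B) {α : Type} [Finite α] {φ : L.Formula α}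
    (hφ : ∀ v : α → A, φ.Realize v) (w : α → B) : φ.Realize w := by
  let σ : L.Sentence := Formula.iAlls α (φ.relabel Sum.inr : L.Formula (Empty ⊕ α))
  have hA : A ⊨ σ := by
    refine Formula.realize_iAlls.2 fun v => ?_
    rw [Formula.realize_relabel, Sum.elim_comp_inr]
    exact hφ v
  have hB : B ⊨ σ := (h.realize_sentence σ).1 hA
  have := Formula.realize_iAlls.1 hB w
  rwa [Formula.realize_relabel, Sum.elim_comp_inr] at this

theorem Isolates.of_elementarilyEquivalent {A B : Type*} [L.Structure A] [L.Structure B]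
    (h : L.ElementarilyEquivalent A B) {α : Type} [Finite α] {θ : L.Formula α}
    (hθ : Isolates A θ) : Isolates B θ := fun φ => by
  refine (hθ φ).imp (fun hv w => ?_) fun hv w => ?_
  · exact Formula.realize_imp.1 (forall_realize_of_elementarilyEquivalent h
      (φ := θ.imp φ) (fun v => Formula.realize_imp.2 (hv v)) w)
  · intro h₁
    exact Formula.realize_not.1 (Formula.realize_imp.1 (forall_realize_of_elementarilyEquivalent h
      (φ := θ.imp φ.not) (fun v => Formula.realize_imp.2 fun h₂ => Formula.realize_not.2 (hv v h₂))
      w) h₁)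

theorem FinitelyManyTypes.of_elementarilyEquivalent {A B : Type*} [L.Structure A] [L.Structure B]
    (h : L.ElementarilyEquivalent A B) (hA : FinitelyManyTypes L A) : FinitelyManyTypes L B := by
  intro k
  obtain ⟨Θ, hf, hi, hc⟩ := hA k
  refine ⟨Θ, hf, fun θ hθ => (hi θ hθ).of_elementarilyEquivalent h, fun w => ?_⟩
  have : Finite Θ := hf
  have := forall_realize_of_elementarilyEquivalent h
    (φ := Formula.iSup fun θ : Θ => (θ : L.Formula (Fin k)))
    (fun v => Formula.realize_iSup.2 (by
      obtain ⟨θ, hθ, hv⟩ := hc v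
      exact ⟨⟨θ, hθ⟩, hv⟩)) w
  obtain ⟨θ, hθ⟩ := Formula.realize_iSup.1 this
  exact ⟨θ, θ.2, hθ⟩

theorem sumElim_comp_finCons {C : Type*} {k : ℕ} (u : Fin k → C) (c : C) :
    (Sum.elim u fun _ : Unit => c) ∘
      (Fin.cons (Sum.inr ()) Sum.inl : Fin (k + 1) → Fin k ⊕ Unit) = Fin.cons c u :=
  funext fun i => by refine Fin.cases ?_ (fun i => ?_) i <;> simp

/-- The extension step of the back-and-forth argument for tuples of the same type. -/
theorem FinitelyManyTypes.exists_extend {A B : Type*} [L.Structure A] [L.Structure B]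
    (h : L.ElementarilyEquivalent A B) (hA : FinitelyManyTypes L A) {k : ℕ} {v : Fin k → A}
    {w : Fin k → B} (hvw : SameType L v w) (a : A) :
    ∃ b : B, SameType L (Fin.cons a v : Fin (k + 1) → A) (Fin.cons b w : Fin (k + 1) → B) := by
  obtain ⟨Θ, -, hi, hc⟩ := hA (k + 1)
  obtain ⟨θ, hθ, hv⟩ := hc (Fin.cons a v)
  let g : Fin (k + 1) → Fin k ⊕ Unit := Fin.cons (Sum.inr ()) Sum.inl
  have h₁ : (Formula.iExs Unit (θ.relabel g)).Realize v :=
    Formula.realize_iExs.2 ⟨fun _ => a, by rwa [Formula.realize_relabel, sumElim_comp_finCons]⟩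
  obtain ⟨b, hb⟩ := Formula.realize_iExs.1 ((hvw _).1 h₁)
  rw [Formula.realize_relabel, show b = fun _ => b () from rfl,
    sumElim_comp_finCons] at hb
  refine ⟨b (), fun φ => ?_⟩
  have hB := (hi θ hθ).of_elementarilyEquivalent h
  rcases hi θ hθ φ with h₂ | h₂
  · have h₃ : ∀ u : Fin (k + 1) → B, θ.Realize u → φ.Realize u := fun u =>
      Formula.realize_imp.1 (forall_realize_of_elementarilyEquivalent h
        (φ := θ.imp φ) (fun v => Formula.realize_imp.2 (h₂ v)) u)
    exact iff_of_true (h₂ _ hv) (h₃ _ hb)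
  · have h₃ : ∀ u : Fin (k + 1) → B, θ.Realize u → φ.not.Realize u := fun u =>
      Formula.realize_imp.1 (forall_realize_of_elementarilyEquivalent h
        (φ := θ.imp φ.not)
        (fun v => Formula.realize_imp.2 fun h => Formula.realize_not.2 (h₂ v h)) u)
    exact iff_of_false (h₂ _ hv) (Formula.realize_not.1 (h₃ _ hb))

/-- If `A` has finitely many types, then tuples of the same type are conjugate. -/
theorem FinitelyManyTypes.exists_equiv {A B : Type*} [L.Structure A] [L.Structure B]
    [Countable A] [Countable B] (hA : FinitelyManyTypes L A) (h : L.ElementarilyEquivalent A B)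
    {k : ℕ} {v : Fin k → A} {w : Fin k → B} (hvw : SameType L v w) :
    ∃ f : A ≃[L] B, ∀ i, f (v i) = w i := by
  let P : List (A × B) → Prop := fun l => ∃ (m : ℕ) (v : Fin m → A) (w : Fin m → B),
    SameType L v w ∧ ∀ p ∈ l, ∃ i, p = (v i, w i)
  obtain ⟨f, hf⟩ := exists_equiv_of_backAndForth P
    (by
      rintro l ⟨m, v, w, hvw, hl⟩ p hp q hq
      obtain ⟨i, rfl⟩ := hl p hp
      obtain ⟨j, rfl⟩ := hl q hq
      have := hvw ((Term.var i).equal (Term.var j))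
      simpa using this)
    (by
      rintro l a ⟨m, v, w, hvw, hl⟩
      obtain ⟨b, hb⟩ := hA.exists_extend h hvw a
      refine ⟨b, m + 1, _, _, hb, fun p hp => ?_⟩
      rcases List.mem_cons.1 hp with rfl | hp
      · exact ⟨0, rfl⟩
      · obtain ⟨i, rfl⟩ := hl p hp
        exact ⟨i.succ, rfl⟩)
    (by
      rintro l b ⟨m, v, w, hvw, hl⟩
      obtain ⟨a, ha⟩ := (hA.of_elementarilyEquivalent h).exists_extend h.symm
        (fun φ => (hvw φ).symm) b
      refine ⟨a, m + 1, _, _, fun φ => (ha φ).symm, fun p hp => ?_⟩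
      rcases List.mem_cons.1 hp with rfl | hp
      · exact ⟨0, rfl⟩
      · obtain ⟨i, rfl⟩ := hl p hp
        exact ⟨i.succ, rfl⟩)
    (List.ofFn fun i => (v i, w i)) ⟨k, v, w, hvw, fun p hp => by
      obtain ⟨i, rfl⟩ := (List.mem_ofFn' _ _).1 hp
      exact ⟨i, rfl⟩⟩
  have key : ∀ s : Finset A, ∃ (m : ℕ) (v' : Fin m → A) (w' : Fin m → B), SameType L v' w' ∧
      (∀ a ∈ s, ∃ i, v' i = a ∧ w' i = f a) ∧ ∀ i, ∃ j, v' j = v i ∧ w' j = w i := fun s => by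
    obtain ⟨l, ⟨m, v', w', h₁, h₂⟩, h₃, h₄⟩ := hf s
    refine ⟨m, v', w', h₁, fun a ha => ?_, fun i => ?_⟩
    · obtain ⟨i, hi⟩ := h₂ _ (h₄ a ha)
      exact ⟨i, (congrArg Prod.fst hi).symm, (congrArg Prod.snd hi).symm⟩
    · obtain ⟨j, hj⟩ := h₂ _ (h₃ ((List.mem_ofFn' _ _).2 ⟨i, rfl⟩))
      exact ⟨j, (congrArg Prod.fst hj).symm, (congrArg Prod.snd hj).symm⟩
  classical
  refine ⟨⟨f, fun {n} F x => ?_, fun {n} R x => ?_⟩, fun i => ?_⟩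
  · obtain ⟨m, v', w', h₁, h₂, -⟩ := key (insert (Structure.funMap F x) (Finset.univ.image x))
    obtain ⟨i, hi, hi'⟩ := h₂ (Structure.funMap F x) (Finset.mem_insert_self _ _)
    have : ∀ t, ∃ i, v' i = x t ∧ w' i = f (x t) := fun t =>
      h₂ (x t) (Finset.mem_insert_of_mem (Finset.mem_image_of_mem _ (Finset.mem_univ t)))
    choose j hj hj' using this
    have := h₁ ((Term.var i : L.Term (Fin m)).equal (Term.func F fun t => Term.var (j t)))
    simp only [Formula.realize_equal, Term.realize_var, Term.realize_func, hi, hi', hj, hj',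
      true_iff] at this
    exact this
  · obtain ⟨m, v', w', h₁, h₂, -⟩ := key (Finset.univ.image x)
    have : ∀ t, ∃ i, v' i = x t ∧ w' i = f (x t) := fun t =>
      h₂ (x t) (Finset.mem_image_of_mem _ (Finset.mem_univ t))
    choose j hj hj' using this
    have := h₁ (R.formula fun t => Term.var (j t))
    simp only [Formula.realize_rel, Term.realize_var, hj, hj'] at this
    exact this.symm
  · obtain ⟨m, v', w', h₁, h₂, h₃⟩ := key {v i}
    obtain ⟨j, hj, hj'⟩ := h₃ i
    obtain ⟨j', hk, hk'⟩ := h₂ (v i) (Finset.mem_singleton_self _)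
    have := h₁ ((Term.var j : L.Term (Fin m)).equal (Term.var j'))
    simp only [Formula.realize_equal, Term.realize_var, hj, hj', hk, hk', true_iff] at this
    exact this.symm

/-- The easy half of the **Ryll-Nardzewski theorem**. -/
theorem FinitelyManyTypes.omegaCategorical {A : Type*} [L.Structure A] [Countable A]
    (hA : FinitelyManyTypes L A) : OmegaCategorical L A := by
  refine ⟨inferInstance, fun N _ _ h => ?_⟩
  obtain ⟨f, -⟩ := hA.exists_equiv h (k := 0) (v := Fin.elim0) (w := Fin.elim0) fun φ => by
    have key : ∀ (C : Type _) [L.Structure C] (u : Fin 0 → C),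
        C ⊨ (Formula.relabel Fin.elim0 φ : L.Sentence) ↔ φ.Realize u := fun C _ u => by
      rw [Sentence.Realize, Formula.realize_relabel]
      exact iff_of_eq (congrArg _ (Subsingleton.elim _ _))
    rw [← key, ← key]
    exact h.realize_sentence _
  exact ⟨f⟩

theorem FinitelyManyTypes.exists_orbit_coloring {A : Type*} [L.Structure A] [Countable A]
    (hA : FinitelyManyTypes L A) :
    ∃ (κ : Type) (_ : Finite κ) (c : A → κ), ∀ a b, c a = c b → ∃ f : A ≃[L] A, f a = b := by
  obtain ⟨Θ, hf, hi, hc⟩ := hA 1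
  have : Finite Θ := hf
  refine ⟨Set Θ, inferInstance, fun a => {θ | θ.1.Realize fun _ => a}, fun a b hab => ?_⟩
  obtain ⟨θ, hθ, ha⟩ := hc fun _ => a
  have hb : θ.Realize fun _ => b := (Set.ext_iff.1 hab ⟨θ, hθ⟩).1 ha
  obtain ⟨f, hf⟩ := hA.exists_equiv (B := A) rfl (v := fun _ => a) (w := fun _ => b) fun φ => by
    rcases hi θ hθ φ with h | h
    · exact iff_of_true (h _ ha) (h _ hb)
    · exact iff_of_false (h _ ha) (h _ hb)
  exact ⟨f, hf 0⟩

theorem finitelyManyTypes_of_orbits {A : Type*} [L.Structure A]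
    (h : ∀ k : ℕ, ∃ (κ : Type*) (_ : Finite κ) (c : (Fin k → A) → κ),
      ∀ v w, c v = c w → ∃ f : A ≃[L] A, ∀ i, f (v i) = w i) : FinitelyManyTypes L A := by
  intro k
  obtain ⟨κ, _, c, hc⟩ := h k
  have same : ∀ v w : Fin k → A, c v = c w → SameType L v w := fun v w hvw φ => by
    obtain ⟨f, hf⟩ := hc v w hvw
    rw [← funext hf]
    exact (StrongHomClass.realize_formula f φ).symm
  classical
  -- `sep v w` holds at `v`, and fails at `w` unless `v` and `w` have the same type
  have hsep : ∀ v w : Fin k → A, ∃ φ : L.Formula (Fin k), φ.Realize v ∧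
      (φ.Realize w → SameType L v w) := fun v w => by
    by_cases hvw : SameType L v w
    · exact ⟨⊤, Formula.realize_top.2 trivial, fun _ => hvw⟩
    · simp only [SameType, not_forall] at hvw
      obtain ⟨φ, hφ⟩ := hvw
      by_cases hv : φ.Realize v
      · exact ⟨φ, hv, fun hw => absurd (iff_of_true hv hw) hφ⟩
      · exact ⟨φ.not, Formula.realize_not.2 hv, fun hw =>
          absurd (iff_of_false hv (Formula.realize_not.1 hw)) hφ⟩
  choose sep hsep₁ hsep₂ using hsep
  let r : Set.range c → Fin k → A := Set.rangeSplitting c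
  have hr : ∀ v : Fin k → A, c (r ⟨c v, v, rfl⟩) = c v := fun v =>
    Set.apply_rangeSplitting c ⟨c v, v, rfl⟩
  let θ : Set.range c → L.Formula (Fin k) := fun i => Formula.iInf fun j => sep (r i) (r j)
  have hθ : ∀ i w, (θ i).Realize w → SameType L (r i) w := fun i w hw => by
    have h₁ := Formula.realize_iInf.1 hw ⟨c w, w, rfl⟩
    have h₂ := same _ _ (hr w)
    exact fun φ => (hsep₂ _ _ ((h₂ _).2 h₁) φ).trans (h₂ φ)
  refine ⟨Set.range θ, Set.finite_range θ, ?_, fun v => ⟨_, ⟨⟨c v, v, rfl⟩, rfl⟩, ?_⟩⟩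
  · rintro _ ⟨i, rfl⟩ φ
    by_cases hi : φ.Realize (r i)
    · exact Or.inl fun w hw => (hθ i w hw φ).1 hi
    · exact Or.inr fun w hw hφ => hi ((hθ i w hw φ).2 hφ)
  · refine Formula.realize_iInf.2 fun j => ?_
    exact (same _ _ (hr v) _).1 (hsep₁ _ _)

/-- The definition of `ω`-categoricity speaks of models in the universe of `A`; they may as well be
taken in the lowest universe. -/
theorem OmegaCategorical.nonempty_equiv {A : Type*} [L.Structure A] (hA : OmegaCategorical L A)
    {N : Type} [L.Structure N] [Countable N] (h : L.ElementarilyEquivalent A N) :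
    Nonempty (A ≃[L] N) := by
  let e := (Equiv.ulift.{_, 0} : ULift N ≃ N).symm
  let _ : L.Structure (ULift N) := e.inducedStructure
  let E : N ≃[L] ULift N := e.inducedStructureEquiv
  obtain ⟨f⟩ := hA.2 (ULift N) (h.trans (StrongHomClass.elementarilyEquivalent E))
  exact ⟨E.symm.comp f⟩

/-- The downward Löwenheim–Skolem theorem, for finite structures too. -/
theorem exists_countable_elementarySubstructure [Countable L.Symbols] {M : Type} [L.Structure M]
    (s : Set M) (hs : s.Finite) : ∃ S : L.ElementarySubstructure M, s ⊆ S ∧ Countable S := by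
  by_cases h : Cardinal.aleph0 ≤ Cardinal.mk M
  · obtain ⟨S, hS, hc⟩ := exists_elementarySubstructure_card_eq L s Cardinal.aleph0.{0} le_rfl
      (by simpa using hs.countable.le_aleph0)
      (by simpa [Language.card] using Cardinal.mk_le_aleph0_iff.2 ‹Countable L.Symbols›)
      (by simpa using h)
    refine ⟨S, hS, ?_⟩
    rw [← Cardinal.mk_le_aleph0_iff]
    simpa using hc.le
  · have : Countable M := Cardinal.mk_le_aleph0_iff.1 (not_le.1 h).le
    exact ⟨⊤, by simp, inferInstance⟩

/-- If some condition on the `k`-subtuple with indices `i`, expressed by a formula, implies the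
complete type of `a`, then this type is isolated. -/
theorem exists_isolates {A : Type*} [L.Structure A] {k : ℕ} (a : Fin k → A) (i : Fin k → ℕ)
    (φ : L.Formula ℕ) (hφ : ∃ v : ℕ → A, φ.Realize v)
    (h : ∀ v : ℕ → A, φ.Realize v → SameType L a (v ∘ i)) :
    ∃ χ : L.Formula (Fin k), Isolates A χ ∧ χ.Realize a := by
  obtain ⟨N, hN⟩ := exists_bound_freeVar (M := A) φ
  let N' := N + Finset.univ.sup i + 1
  have hi : ∀ m, i m < N' := fun m => by
    have : i m ≤ Finset.univ.sup i := Finset.le_sup (Finset.mem_univ m)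
    omega
  let r : ℕ → Fin N' := fun j => if hj : j < N' then ⟨j, hj⟩ else ⟨0, by omega⟩
  -- `χ y` says that `y` is the subtuple with indices `i` of some tuple that satisfies `φ`
  let χ : L.Formula (Fin k) := Formula.iExs (Fin N') ((φ.relabel fun j => Sum.inr (r j)) ⊓
    Formula.iInf fun m : Fin k => (Term.var (Sum.inl m) : L.Term (Fin k ⊕ Fin N')).equal
      (Term.var (Sum.inr (r (i m)))))
  have hχ : ∀ y : Fin k → A, χ.Realize y ↔ ∃ v : ℕ → A, φ.Realize v ∧ y = v ∘ i := by
    intro y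
    simp only [χ, Formula.realize_iExs, Formula.realize_inf, Formula.realize_relabel,
      Formula.realize_iInf, Formula.realize_equal, Term.realize_var, Sum.elim_inl, Sum.elim_inr]
    constructor
    · rintro ⟨u, h₁, h₂⟩
      exact ⟨_, h₁, funext h₂⟩
    · rintro ⟨v, h₁, rfl⟩
      refine ⟨fun j => v j, ?_, fun m => ?_⟩
      · refine (hN _ _ fun j hj => ?_).1 h₁
        have : j < N' := by omega
        simp [r, this]
      · simp [r, hi m]
  have same : ∀ y, χ.Realize y → SameType L a y := fun y hy => by
    obtain ⟨v, hv, rfl⟩ := (hχ y).1 hy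
    exact h v hv
  refine ⟨χ, fun ψ => ?_, ?_⟩
  · by_cases ha : ψ.Realize a
    · exact Or.inl fun y hy => (same y hy ψ).1 ha
    · exact Or.inr fun y hy hψ => ha ((same y hy ψ).2 hψ)
  · obtain ⟨v, hv⟩ := hφ
    exact (h v hv χ).2 ((hχ _).2 ⟨v, hv, rfl⟩)

/-- The hard half of the **Ryll-Nardzewski theorem**: if no finite set of isolating formulas covers
the `k`-tuples of `A`, then by compactness some countable model realizes a type that is not isolated,
and some generic countable model omits it. -/
theorem OmegaCategorical.finitelyManyTypes [Countable L.Symbols] {A : Type*} [L.Structure A]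
    [Nonempty A] (hA : OmegaCategorical L A) : FinitelyManyTypes L A := by
  by_contra hfin
  simp only [FinitelyManyTypes, not_forall] at hfin
  obtain ⟨k, hk⟩ := hfin
  have h₁ : ∀ F : Finset {θ : L.Formula (Fin k) // Isolates A θ},
      {v : Fin k → A | ∀ θ ∈ F, ¬ θ.1.Realize v}.Nonempty := fun F => by
    by_contra hF
    refine hk ⟨Subtype.val '' (F : Set {θ : L.Formula (Fin k) // Isolates A θ}),
      F.finite_toSet.image _, ?_, fun v => ?_⟩
    · rintro _ ⟨θ, -, rfl⟩
      exact θ.2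
    · by_contra hv
      refine hF ⟨v, fun θ hθ h => hv ⟨θ, ⟨θ, hθ, rfl⟩, h⟩⟩
  classical
  obtain ⟨M, _, w, _, hM, hw⟩ := exists_realize_of_directed (L := L) _ h₁ fun F G =>
    ⟨F ∪ G, fun v hv θ hθ => hv θ (Finset.mem_union_left _ hθ),
      fun v hv θ hθ => hv θ (Finset.mem_union_right _ hθ)⟩
  obtain ⟨S, hwS, _⟩ := exists_countable_elementarySubstructure (L := L) (Set.range w)
    (Set.finite_range w)
  obtain ⟨f⟩ := hA.nonempty_equiv (hM.trans S.elementarilyEquivalent.symm)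
  let w' : Fin k → S := fun i => ⟨w i, hwS ⟨i, rfl⟩⟩
  -- a tuple of elements of `A` whose type is not isolated
  let a : Fin k → A := fun i => f.symm (w' i)
  have ha : ∀ θ : L.Formula (Fin k), Isolates A θ → ¬ θ.Realize a := fun θ hθ h => by
    have h₂ : θ.Realize w' := (StrongHomClass.realize_formula f.symm θ).1 h
    have h₃ : θ.Realize w := (S.subtype.map_formula θ w').2 h₂
    exact Formula.realize_not.1 (hw θ.not ⟨{⟨θ, hθ⟩}, fun v hv =>
      Formula.realize_not.2 (hv ⟨θ, hθ⟩ (Finset.mem_singleton_self _))⟩) h₃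
  obtain ⟨N, _, u, hu, hN, hD⟩ := exists_generic (L := L) (A := A) (ι := Fin k → ℕ)
    (fun i => {ψ | ∃ θ : L.Formula (Fin k), ¬ θ.Realize a ∧ ψ = θ.relabel i}) fun i φ hφ => by
      by_contra hno
      have same : ∀ v : ℕ → A, φ.Realize v → SameType L a (v ∘ i) := by
        have h₂ : ∀ (v : ℕ → A) (θ : L.Formula (Fin k)), φ.Realize v → ¬ θ.Realize a →
            ¬ θ.Realize (v ∘ i) := fun v θ hv hθ h =>
          hno ⟨_, ⟨θ, hθ, rfl⟩, v, hv, Formula.realize_relabel.2 h⟩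
        refine fun v hv θ => ⟨fun h => ?_, fun h => ?_⟩
        · by_contra hn
          exact h₂ v θ.not hv (fun h' => Formula.realize_not.1 h' h) (Formula.realize_not.2 hn)
        · by_contra hn
          exact h₂ v θ hv hn h
      obtain ⟨χ, hχ, hχa⟩ := exists_isolates a i φ hφ same
      exact ha χ hχ hχa
  have : Countable N := hu.countable
  obtain ⟨f'⟩ := hA.nonempty_equiv hN
  choose i hi using fun m => hu (f' (a m))
  obtain ⟨_, ⟨θ, hθ, rfl⟩, h⟩ := hD i
  rw [Formula.realize_relabel] at h
  refine hθ ((StrongHomClass.realize_formula f' θ).1 ?_)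
  rwa [show f' ∘ a = u ∘ i from funext fun m => (hi m).symm]

end RyllNardzewski

/-! ### Stratified spaces -/

/-- A stratification of `X` by the poset `S`, with invariants `M`, `F`, `g`: a surjection onto `S`
whose fibres are the strata, such that the closure of a stratum is the union of the strata below it;
`M` indexes the strata with compact closure, `F` the finite strata, and `g` counts the isolated
points of the strata. -/
structure IsStratification {X : Type*} [TopologicalSpace X] {S : Type*} [PartialOrder S]
    (M F : Set S) (g : S → ℕ) (π : X → S) : Prop where
  surjective : Function.Surjective π
  closure_fiber : ∀ s, closure (π ⁻¹' {s}) = π ⁻¹' Set.Iic s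
  mem_M : ∀ s, s ∈ M ↔ IsCompact (closure (π ⁻¹' {s}))
  mem_F : ∀ s, s ∈ F ↔ (π ⁻¹' {s}).Finite
  encard_isolated : ∀ s, (π ⁻¹' {s} \ derivedSet (π ⁻¹' {s})).encard = g s

/-- The accumulation points of the stratum `s`. -/
def accSet {X : Type*} [TopologicalSpace X] {S : Type*} (π : X → S) (s : S) : Set X :=
  derivedSet (π ⁻¹' {s})

/-- The isolated points of the stratum `s`. -/
def isoSet {X : Type*} [TopologicalSpace X] {S : Type*} (π : X → S) (s : S) : Set X :=
  π ⁻¹' {s} \ accSet π s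

theorem mem_isoSet_or {X : Type*} [TopologicalSpace X] {S : Type*} (π : X → S) (x : X) :
    x ∈ isoSet π (π x) ∨ x ∈ accSet π (π x) := by
  by_cases hx : x ∈ accSet π (π x)
  · exact Or.inr hx
  · exact Or.inl ⟨rfl, hx⟩

theorem isClosed_accSet {X : Type*} [TopologicalSpace X] [T1Space X] {S : Type*} (π : X → S)
    (s : S) : IsClosed (accSet π s) := isClosed_derivedSet _

theorem derivedSet_eq_empty_of_finite {X : Type*} [TopologicalSpace X] [T1Space X] {A : Set X}
    (hA : A.Finite) : derivedSet A = ∅ := by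
  refine Set.eq_empty_of_forall_notMem fun x hx => ?_
  have h₁ : (A \ {x}).Finite := hA.subset Set.sdiff_subset
  obtain ⟨y, ⟨hy, hyA⟩, hyx⟩ := accPt_iff_nhds.1 hx _
    (h₁.isClosed.isOpen_compl.mem_nhds fun h => h.2 rfl)
  exact hy ⟨hyA, hyx⟩

namespace IsStratification

variable {X : Type*} [TopologicalSpace X] {S : Type*} [PartialOrder S]
  {M F : Set S} {g : S → ℕ} {π : X → S}

theorem finite_isoSet (h : IsStratification M F g π) (s : S) : (isoSet π s).Finite := by
  refine Set.finite_of_encard_le_coe (k := g s) (h.encard_isolated s).le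

theorem le_of_mem_accSet (h : IsStratification M F g π) {s : S} {x : X} (hx : x ∈ accSet π s) :
    π x ≤ s := by
  have := derivedSet_subset_closure _ hx
  rwa [h.closure_fiber] at this

theorem mem_accSet_of_lt (h : IsStratification M F g π) {s : S} {x : X} (hx : π x < s) :
    x ∈ accSet π s := by
  have : x ∈ closure (π ⁻¹' {s}) := by
    rw [h.closure_fiber]
    exact hx.le
  rw [closure_eq_self_union_derivedSet] at this
  exact this.resolve_left hx.ne

theorem accSet_mono (h : IsStratification M F g π) {s t : S} (hst : s ≤ t) :
    accSet π s ⊆ accSet π t := by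
  rcases hst.eq_or_lt with rfl | hst
  · exact subset_rfl
  · exact fun x hx => h.mem_accSet_of_lt ((h.le_of_mem_accSet hx).trans_lt hst)

/-- Every neighbourhood of an accumulation point of a stratum contains infinitely many points of the
stratum which are themselves accumulation points of it. -/
theorem exists_mem_accSet [T1Space X] (h : IsStratification M F g π) {s : S} {x : X}
    (hx : x ∈ accSet π s) {U : Set X} (hU : IsOpen U) (hxU : x ∈ U) {E : Set X} (hE : E.Finite) :
    ∃ y ∈ U, π y = s ∧ y ∈ accSet π s ∧ y ∉ E := by
  have hE' : ((E ∪ isoSet π s) \ {x}).Finite :=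
    (hE.union (h.finite_isoSet s)).subset Set.sdiff_subset
  have hN : U ∩ ((E ∪ isoSet π s) \ {x})ᶜ ∈ 𝓝 x :=
    (hU.inter hE'.isClosed.isOpen_compl).mem_nhds ⟨hxU, fun h => h.2 rfl⟩
  obtain ⟨y, ⟨⟨hyU, hyE⟩, hys⟩, hyx⟩ := accPt_iff_nhds.1 hx _ hN
  have hy : y ∉ E ∪ isoSet π s := fun hy => hyE ⟨hy, hyx⟩
  refine ⟨y, hyU, hys, ?_, fun h => hy (Or.inl h)⟩
  by_contra hn
  exact hy (Or.inr ⟨hys, hn⟩)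

theorem accSet_nonempty_iff [T1Space X] (h : IsStratification M F g π) (s : S) :
    (accSet π s).Nonempty ↔ s ∉ F := by
  rw [h.mem_F]
  constructor
  · rintro ⟨x, hx⟩ hfin
    obtain ⟨y, -, h₁, -, h₂⟩ := h.exists_mem_accSet hx isOpen_univ trivial hfin
    exact h₂ h₁
  · intro hinf
    by_contra hne
    exact hinf ((h.finite_isoSet s).subset fun x hx => ⟨hx, fun hx' => hne ⟨x, hx'⟩⟩)

theorem isCompact_accSet_iff [T1Space X] (h : IsStratification M F g π) (s : S) :
    IsCompact (accSet π s) ↔ s ∈ M := by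
  rw [h.mem_M, closure_eq_self_union_derivedSet]
  constructor
  · intro hc
    convert (h.finite_isoSet s).isCompact.union hc using 1
    exact Set.sdiff_union_self.symm
  · exact fun hc => hc.of_isClosed_subset (isClosed_accSet π s) Set.subset_union_right

end IsStratification

/-- The invariants of a subset `W` of `X` and a subset `W'` of `X'` agree: they contain equally many
isolated points of each stratum, they contain accumulation points of the same strata, and these form
a compact set in `W` if and only if they do in `W'`. -/
def SameInvariants {X X' : Type*} [TopologicalSpace X] [TopologicalSpace X'] {S : Type*}
    (π : X → S) (π' : X' → S) (W : Set X) (W' : Set X') : Prop :=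
  ∀ s, (isoSet π s ∩ W).encard = (isoSet π' s ∩ W').encard ∧
    ((accSet π s ∩ W).Nonempty ↔ (accSet π' s ∩ W').Nonempty) ∧
    (IsCompact (accSet π s ∩ W) ↔ IsCompact (accSet π' s ∩ W'))

theorem SameInvariants.symm {X X' : Type*} [TopologicalSpace X] [TopologicalSpace X'] {S : Type*}
    {π : X → S} {π' : X' → S} {W : Set X} {W' : Set X'} (h : SameInvariants π π' W W') :
    SameInvariants π' π W' W :=
  fun s => ⟨(h s).1.symm, (h s).2.1.symm, (h s).2.2.symm⟩

/-- Between a compact set and an open set there is a compact open set. -/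
theorem exists_compact_open_between {X : Type*} [TopologicalSpace X]
    (hX : IsTopologicalBasis {U : Set X | IsCompact U ∧ IsOpen U}) {K O : Set X}
    (hK : IsCompact K) (hO : IsOpen O) (hKO : K ⊆ O) :
    ∃ V, IsCompact V ∧ IsOpen V ∧ K ⊆ V ∧ V ⊆ O := by
  refine hK.induction_on (p := fun s => ∃ V, IsCompact V ∧ IsOpen V ∧ s ⊆ V ∧ V ⊆ O) ?_ ?_ ?_ ?_
  · exact ⟨∅, isCompact_empty, isOpen_empty, subset_rfl, Set.empty_subset _⟩
  · rintro s t hst ⟨V, h₁, h₂, h₃, h₄⟩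
    exact ⟨V, h₁, h₂, hst.trans h₃, h₄⟩
  · rintro s t ⟨V, h₁, h₂, h₃, h₄⟩ ⟨V', h₁', h₂', h₃', h₄'⟩
    exact ⟨V ∪ V', h₁.union h₁', h₂.union h₂', Set.union_subset_union h₃ h₃',
      Set.union_subset h₄ h₄'⟩
  · intro x hx
    obtain ⟨V, ⟨h₁, h₂⟩, h₃, h₄⟩ := hX.exists_subset_of_mem_open (hKO hx) hO
    exact ⟨V, mem_nhdsWithin_of_mem_nhds (h₂.mem_nhds h₃), V, h₁, h₂, subset_rfl, h₄⟩

/-- Removing a compact open set affects no condition of compactness. -/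
theorem isCompact_accSet_diff_iff {X : Type*} [TopologicalSpace X] [T1Space X]
    {S : Type*} {π : X → S} {V : Set X} (hV : IsCompact V) (hVo : IsOpen V) (W : Set X)
    (hVW : V ⊆ W) (s : S) :
    IsCompact (accSet π s ∩ (W \ V)) ↔ IsCompact (accSet π s ∩ W) := by
  have hc : IsCompact (accSet π s ∩ V) :=
    hV.inter_left (isClosed_accSet π s)
  constructor
  · intro h
    convert h.union hc using 1
    rw [← Set.inter_union_distrib_left, Set.sdiff_union_of_subset hVW]
  · intro h
    rw [← Set.inter_sdiff_assoc]
    exact h.diff hVo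

section Extension

variable {X X' : Type*} [TopologicalSpace X] [TopologicalSpace X'] [T2Space X] [T2Space X']
  {S : Type*} [PartialOrder S] {M F : Set S} {g : S → ℕ} {π : X → S} {π' : X' → S}

/-- The extension step of the back-and-forth argument, for a compact open subset `V` of `W`. The set
`V'` is chosen between a compact set of points that it must contain and an open set of points that it
may contain. -/
theorem SameInvariants.exists_extension_of_subset [Finite S] (h : IsStratification M F g π)
    (h' : IsStratification M F g π')
    (hX' : IsTopologicalBasis {U : Set X' | IsCompact U ∧ IsOpen U}) {W : Set X} {W' : Set X'}
    (hW' : IsOpen W') (inv : SameInvariants π π' W W') {V : Set X} (hV : IsCompact V)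
    (hVo : IsOpen V) (hVW : V ⊆ W) :
    ∃ V' ⊆ W', IsCompact V' ∧ IsOpen V' ∧ SameInvariants π π' V V' ∧
      SameInvariants π π' (W \ V) (W' \ V') := by
  -- the strata all of whose accumulation points in `W` lie in `V`
  let D : Set S := {t | (accSet π t ∩ W).Nonempty ∧ ¬ (accSet π t ∩ (W \ V)).Nonempty}
  have hD : ∀ t ∈ D, accSet π t ∩ W ⊆ V := fun t ht x hx => by
    by_contra hn
    exact ht.2 ⟨x, hx.1, hx.2, hn⟩
  -- the accumulation points of these strata have to lie in `V'`
  let K : Set X' := ⋃ t ∈ D, accSet π' t ∩ W'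
  have hK : IsCompact K := by
    refine (Set.toFinite D).isCompact_biUnion fun t ht => ((inv t).2.2).1 ?_
    have : accSet π t ∩ W = accSet π t ∩ V :=
      Set.Subset.antisymm (fun x hx => ⟨hx.1, hD t ht hx⟩) fun x hx => ⟨hx.1, hVW hx.2⟩
    rw [this]
    exact hV.inter_left (isClosed_accSet π t)
  -- the isolated points of the stratum `t` that are put into `V'`
  have hI : ∀ t, ∃ I ⊆ isoSet π' t ∩ W', I.encard = (isoSet π t ∩ V).encard := fun t => by
    refine Set.exists_subset_encard_eq ?_
    rw [← (inv t).1]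
    exact Set.encard_le_encard (Set.inter_subset_inter_right _ hVW)
  choose I hIsub hIcard using hI
  have hfin : ∀ t, (isoSet π' t ∩ W').Finite := fun t =>
    (h'.finite_isoSet t).subset Set.inter_subset_left
  have hIall : ∀ t, isoSet π t ∩ W ⊆ V → I t = isoSet π' t ∩ W' := fun t ht => by
    refine Set.Finite.eq_of_subset_of_encard_le ((hfin t).subset (hIsub t)) (hIsub t) ?_
    rw [hIcard, ← (inv t).1]
    exact Set.encard_le_encard fun x hx => ⟨hx.1, ht hx⟩
  have hIne : ∀ t, (I t).Nonempty → (isoSet π t ∩ V).Nonempty := fun t ht => by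
    rw [← Set.encard_pos, ← hIcard, Set.encard_pos]
    exact ht
  -- accumulation points `p t` to be put into `V'`, and `q t` to be kept out of it
  have hp : ∀ t : {t // (accSet π t ∩ V).Nonempty}, ∃ p ∈ W', π' p = t ∧ p ∈ accSet π' t := by
    rintro ⟨t, ht⟩
    obtain ⟨y, hy, hyW⟩ := (inv t).2.1.1 (ht.mono (Set.inter_subset_inter_right _ hVW))
    obtain ⟨p, h₁, h₂, h₃, -⟩ := h'.exists_mem_accSet hy hW' hyW Set.finite_empty
    exact ⟨p, h₁, h₂, h₃⟩
  choose p hpW hpπ hpacc using hp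
  have hq : ∀ t : {t // (accSet π t ∩ (W \ V)).Nonempty},
      ∃ q ∈ W', π' q = t ∧ q ∈ accSet π' t ∧ q ∉ Set.range p := by
    rintro ⟨t, ht⟩
    obtain ⟨y, hy, hyW⟩ := (inv t).2.1.1 (ht.mono (Set.inter_subset_inter_right _ Set.sdiff_subset))
    exact h'.exists_mem_accSet hy hW' hyW (Set.finite_range p)
  choose q hqW hqπ hqacc hqp using hq
  -- the accumulation points of the strata that have none in `V` must be avoided, and so must the
  -- isolated points that have not been chosen
  let N : Set X' := ⋃ t ∈ {t | ¬ (accSet π t ∩ V).Nonempty}, accSet π' t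
  let J : Set X' := ⋃ t, (isoSet π' t ∩ W') \ I t
  have hKO : K ∪ Set.range p ∪ ⋃ t, I t ⊆ W' \ (N ∪ Set.range q ∪ J) := by
    rintro x ((hx | ⟨t, rfl⟩) | hx)
    · simp only [K, Set.mem_iUnion] at hx
      obtain ⟨s, hs, hxs, hxW⟩ := hx
      refine ⟨hxW, ?_⟩
      rintro ((hxN | ⟨t, rfl⟩) | hxJ)
      · simp only [N, Set.mem_iUnion] at hxN
        obtain ⟨t, ht, hxt⟩ := hxN
        have hrs := h'.le_of_mem_accSet hxs
        have hrt := h'.le_of_mem_accSet hxt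
        rcases mem_isoSet_or π' x with hx | hx
        · have hrs' : π' x < s := hrs.lt_of_ne fun he => hx.2 (he ▸ hxs)
          have hrt' : π' x < t := hrt.lt_of_ne fun he => hx.2 (he ▸ hxt)
          have : (isoSet π (π' x) ∩ W).Nonempty := by
            rw [← Set.encard_pos, (inv _).1, Set.encard_pos]
            exact ⟨x, hx, hxW⟩
          obtain ⟨y, hy, hyW⟩ := this
          have hyπ : π y = π' x := hy.1
          refine ht ⟨y, h.mem_accSet_of_lt (hyπ ▸ hrt'), hD s hs ⟨h.mem_accSet_of_lt ?_, hyW⟩⟩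
          exact hyπ ▸ hrs'
        · obtain ⟨y, hy, hyW⟩ := (inv _).2.1.2 ⟨x, hx, hxW⟩
          exact ht ⟨y, h.accSet_mono hrt hy, hD s hs ⟨h.accSet_mono hrs hy, hyW⟩⟩
      · have hts : t.1 ≤ s := hqπ t ▸ h'.le_of_mem_accSet hxs
        obtain ⟨y, hy, hyW⟩ := t.2
        exact hs.2 ⟨y, h.accSet_mono hts hy, hyW⟩
      · simp only [J, Set.mem_iUnion] at hxJ
        obtain ⟨t, ⟨hxt, -⟩, hxI⟩ := hxJ
        refine hxI (hIall t (fun y hy => hD s hs ⟨h.mem_accSet_of_lt ?_, hy.2⟩) ▸ ⟨hxt, hxW⟩)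
        have hxt' : π' x = t := hxt.1
        rw [show π y = t from hy.1.1]
        refine (hxt' ▸ h'.le_of_mem_accSet hxs : t ≤ s).lt_of_ne ?_
        rintro rfl
        exact hxt.2 hxs
    · refine ⟨hpW t, ?_⟩
      rintro ((hxN | ⟨t', hx⟩) | hxJ)
      · simp only [N, Set.mem_iUnion] at hxN
        obtain ⟨t', ht', hx⟩ := hxN
        obtain ⟨y, hy, hyV⟩ := t.2
        exact ht' ⟨y, h.accSet_mono (hpπ t ▸ h'.le_of_mem_accSet hx) hy, hyV⟩
      · exact hqp t' ⟨t, hx.symm⟩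
      · simp only [J, Set.mem_iUnion] at hxJ
        obtain ⟨t', ⟨hx, -⟩, -⟩ := hxJ
        have : t' = t := (hx.1 : π' (p t) = t').symm.trans (hpπ t)
        exact hx.2 (this ▸ hpacc t)
    · obtain ⟨t, hx⟩ := Set.mem_iUnion.1 hx
      have hxt := (hIsub t hx).1
      refine ⟨(hIsub t hx).2, ?_⟩
      rintro ((hxN | ⟨t', rfl⟩) | hxJ)
      · simp only [N, Set.mem_iUnion] at hxN
        obtain ⟨t', ht', hx'⟩ := hxN
        obtain ⟨y, hy, hyV⟩ := hIne t ⟨x, hx⟩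
        refine ht' ⟨y, h.mem_accSet_of_lt ?_, hyV⟩
        rw [show π y = t from hy.1]
        refine (show π' x = t from hxt.1) ▸ (h'.le_of_mem_accSet hx').lt_of_ne ?_
        rintro rfl
        exact hxt.2 ((show π' x = t from hxt.1) ▸ hx')
      · have : t = t' := (hxt.1 : π' (q t') = t).symm.trans (hqπ t')
        exact hxt.2 (this ▸ hqacc t')
      · simp only [J, Set.mem_iUnion] at hxJ
        obtain ⟨t', ⟨hx', -⟩, hxI⟩ := hxJ
        have : t = t' := (hxt.1 : π' x = t).symm.trans hx'.1
        exact hxI (this ▸ hx)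
  obtain ⟨V', hV', hVo', hKV, hVO⟩ := exists_compact_open_between hX'
    ((hK.union (Set.finite_range p).isCompact).union
      (Set.finite_iUnion fun t => (hfin t).subset (hIsub t)).isCompact)
    (hW'.sdiff (((((Set.toFinite _).isClosed_biUnion fun t _ =>
      isClosed_accSet π' t).union (Set.finite_range q).isClosed).union
      (Set.finite_iUnion fun t => (hfin t).subset Set.sdiff_subset).isClosed) :
        IsClosed (N ∪ Set.range q ∪ J))) hKO
  have hVW' : V' ⊆ W' := hVO.trans Set.sdiff_subset
  have hiso : ∀ t, isoSet π' t ∩ V' = I t := fun t => by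
    refine Set.Subset.antisymm (fun x hx => ?_) fun x hx =>
      ⟨(hIsub t hx).1, hKV (Or.inr (Set.mem_iUnion.2 ⟨t, hx⟩))⟩
    by_contra hn
    exact (hVO hx.2).2 (Or.inr (Set.mem_iUnion.2 ⟨t, ⟨hx.1, hVW' hx.2⟩, hn⟩))
  refine ⟨V', hVW', hV', hVo', fun t => ⟨?_, ⟨?_, ?_⟩, ?_⟩, fun t => ⟨?_, ⟨?_, ?_⟩, ?_⟩⟩
  · rw [hiso, hIcard]
  · exact fun ht => ⟨p ⟨t, ht⟩, hpacc ⟨t, ht⟩, hKV (Or.inl (Or.inr ⟨_, rfl⟩))⟩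
  · rintro ⟨x, hx, hxV⟩
    by_contra ht
    exact (hVO hxV).2 (Or.inl (Or.inl (Set.mem_biUnion (show t ∈ {t | _} from ht) hx)))
  · exact iff_of_true (hV.inter_left (isClosed_accSet π t))
      (hV'.inter_left (isClosed_accSet π' t))
  · have e₁ : isoSet π t ∩ (W \ V) = (isoSet π t ∩ W) \ (isoSet π t ∩ V) := by
      ext x; simp only [Set.mem_inter_iff, Set.mem_sdiff]; tauto
    have e₂ : isoSet π' t ∩ (W' \ V') = (isoSet π' t ∩ W') \ (isoSet π' t ∩ V') := by
      ext x; simp only [Set.mem_inter_iff, Set.mem_sdiff]; tauto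
    have h₁ := Set.encard_sdiff_add_encard_of_subset
      (Set.inter_subset_inter_right (isoSet π t) hVW)
    have h₂ := Set.encard_sdiff_add_encard_of_subset
      (Set.inter_subset_inter_right (isoSet π' t) hVW')
    rw [← e₁] at h₁
    rw [← e₂, ← (inv t).1, ← h₁, hiso, hIcard] at h₂
    refine (WithTop.add_right_inj ?_).1 h₂.symm
    exact Set.encard_ne_top_iff.2 ((h.finite_isoSet t).subset Set.inter_subset_left)
  · exact fun ht => ⟨q ⟨t, ht⟩, hqacc ⟨t, ht⟩, hqW ⟨t, ht⟩, fun hn =>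
      (hVO hn).2 (Or.inl (Or.inr ⟨_, rfl⟩))⟩
  · rintro ⟨x, hx, hxW, hxV⟩
    by_contra ht
    exact hxV (hKV (Or.inl (Or.inl (Set.mem_biUnion
      (show t ∈ D from ⟨(inv t).2.1.2 ⟨x, hx, hxW⟩, ht⟩) ⟨hx, hxW⟩))))
  · rw [isCompact_accSet_diff_iff hV hVo W hVW, isCompact_accSet_diff_iff hV' hVo' W' hVW']
    exact (inv t).2.2

/-- The extension step of the back-and-forth argument: a splitting of `W` by a compact open set can
be matched by a splitting of `W'`. -/
theorem SameInvariants.exists_extension [Finite S] (h : IsStratification M F g π)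
    (h' : IsStratification M F g π')
    (hX' : IsTopologicalBasis {U : Set X' | IsCompact U ∧ IsOpen U}) {W : Set X} {W' : Set X'}
    (hW : IsClopen W) (hW' : IsOpen W') (inv : SameInvariants π π' W W') {V : Set X}
    (hV : IsCompact V) (hVo : IsOpen V) :
    ∃ V' ⊆ W', IsCompact V' ∧ IsOpen V' ∧ SameInvariants π π' (W ∩ V) V' ∧
      SameInvariants π π' (W \ V) (W' \ V') := by
  have := inv.exists_extension_of_subset h h' hX' hW' (hV.inter_left hW.1) (hW.2.inter hVo)
    Set.inter_subset_left
  rwa [Set.sdiff_self_inter] at this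

end Extension

/-! ### Stone duality for Boolean rings without identity -/

section Idempotent

variable {R : Type*} [NonUnitalRing R]

theorem add_self_of_idem (h : ∀ a : R, a * a = a) (a : R) : a + a = 0 := by
  have := h (a + a)
  rw [mul_add, add_mul, h] at this
  simpa using this

theorem mul_comm_of_idem (h : ∀ a : R, a * a = a) (a b : R) : a * b = b * a := by
  have h₁ := h (a + b)
  rw [mul_add, add_mul, add_mul, h, h] at h₁
  have h₂ : b * a + a * b = 0 := by
    have : a + b + (b * a + a * b) = a + b := by
      calc a + b + (b * a + a * b) = a + b * a + (a * b + b) := by abel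
        _ = a + b := h₁
    simpa using this
  have h₃ := add_self_of_idem h (b * a)
  exact add_left_cancel (h₂.trans h₃.symm)

/-- An element outside an ideal of a Boolean ring is separated from it by a homomorphism to the
two-element field. -/
theorem exists_hom_of_notMem (h : ∀ a : R, a * a = a) (J : TwoSidedIdeal R) {a : R} (ha : a ∉ J) :
    ∃ x : R →ₙ+* ZMod 2, x a = 1 ∧ ∀ b ∈ J, x b = 0 := by
  obtain ⟨I, hJI, hI⟩ := zorn_le_nonempty₀ {I : TwoSidedIdeal R | a ∉ I} (by
    intro c hc hchain I₀ hI₀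
    let U : TwoSidedIdeal R := TwoSidedIdeal.mk' {b | ∃ I ∈ c, b ∈ I}
      ⟨I₀, hI₀, I₀.zero_mem⟩
      (by
        rintro b b' ⟨I, hI, hb⟩ ⟨I', hI', hb'⟩
        rcases hchain.total hI hI' with hle | hle
        · exact ⟨I', hI', I'.add_mem (hle hb) hb'⟩
        · exact ⟨I, hI, I.add_mem hb (hle hb')⟩)
      (by
        rintro b ⟨I, hI, hb⟩
        exact ⟨I, hI, I.neg_mem hb⟩)
      (by
        rintro r b ⟨I, hI, hb⟩
        exact ⟨I, hI, I.mul_mem_left _ _ hb⟩)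
      (by
        rintro b r ⟨I, hI, hb⟩
        exact ⟨I, hI, I.mul_mem_right _ _ hb⟩)
    have hU : ∀ b, b ∈ U ↔ ∃ I ∈ c, b ∈ I := fun b => TwoSidedIdeal.mem_mk' ..
    refine ⟨U, fun haU => ?_, fun I hI b hb => (hU b).2 ⟨I, hI, hb⟩⟩
    obtain ⟨I, hI, haI⟩ := (hU a).1 haU
    exact hc hI haI) J ha
  have haI : a ∉ I := hI.prop
  -- for each `b`, the ideal `I` contains one of `a * b` and `a * (1 - b)`
  have key : ∀ b, a * b ∉ I → a + a * b ∈ I := fun b hb => by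
    let C : TwoSidedIdeal R := TwoSidedIdeal.mk' {c | a * b * c ∈ I}
      (by simp [I.zero_mem])
      (fun {c c'} hc hc' => by
        simp only [Set.mem_ofPred_eq, mul_add] at hc hc' ⊢
        exact I.add_mem hc hc')
      (fun {c} hc => by
        simp only [Set.mem_ofPred_eq, mul_neg] at hc ⊢
        exact I.neg_mem hc)
      (fun {r c} hc => by
        simp only [Set.mem_ofPred_eq] at hc ⊢
        rw [mul_comm_of_idem h r c, ← mul_assoc]
        exact I.mul_mem_right _ _ hc)
      (fun {c r} hc => by
        simp only [Set.mem_ofPred_eq] at hc ⊢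
        rw [← mul_assoc]
        exact I.mul_mem_right _ _ hc)
    have hC : ∀ c, c ∈ C ↔ a * b * c ∈ I := fun c => TwoSidedIdeal.mem_mk' ..
    have haC : a ∉ C := fun haC => hb (by
      have := (hC a).1 haC
      rwa [mul_comm_of_idem h (a * b) a, ← mul_assoc, h] at this)
    have hIC : I ≤ C := fun c hc => (hC c).2 (I.mul_mem_left _ _ hc)
    refine hI.le_of_ge haC hIC ((hC _).2 ?_)
    rw [mul_add, h, mul_comm_of_idem h (a * b) a, ← mul_assoc, h, add_self_of_idem h]
    exact I.zero_mem
  have excl : ∀ b, a * b ∈ I → a + a * b ∉ I := fun b hb hb' => haI (by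
    simpa using I.sub_mem hb' hb)
  classical
  let x : R → ZMod 2 := fun b => if a * b ∈ I then 0 else 1
  have hx₀ : ∀ b, a * b ∈ I → x b = 0 := fun b hb => if_pos hb
  have hx₁ : ∀ b, a + a * b ∈ I → x b = 1 := fun b hb => if_neg fun hb' => excl b hb' hb
  have cases : ∀ b, a * b ∈ I ∨ a + a * b ∈ I := fun b => or_iff_not_imp_left.2 (key b)
  have h2 := add_self_of_idem h
  refine ⟨{ toFun := x, map_mul' := fun b c => ?_, map_zero' := ?_, map_add' := fun b c => ?_ },
    ?_, fun b hb => ?_⟩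
  · rcases cases b with hb | hb
    · rw [hx₀ b hb, hx₀ _ (by rw [← mul_assoc]; exact I.mul_mem_right _ _ hb), zero_mul]
    · rcases cases c with hc | hc
      · rw [hx₀ c hc, hx₀ _ (by
          rw [mul_comm_of_idem h b c, ← mul_assoc]; exact I.mul_mem_right _ _ hc), mul_zero]
      · rw [hx₁ b hb, hx₁ c hc, hx₁ _ ?_, one_mul]
        have := I.add_mem hb (I.mul_mem_left b _ hc)
        have e : a + a * b + b * (a + a * c) = a + a * (b * c) := by
          rw [mul_add, mul_comm_of_idem h b a, ← mul_assoc b, mul_comm_of_idem h b a, mul_assoc,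
            ← add_assoc, add_assoc a, h2, add_zero]
        rwa [e] at this
  · exact hx₀ 0 (by simp [I.zero_mem])
  · rcases cases b with hb | hb <;> rcases cases c with hc | hc
    · rw [hx₀ b hb, hx₀ c hc, hx₀ _ (by rw [mul_add]; exact I.add_mem hb hc), add_zero]
    · rw [hx₀ b hb, hx₁ c hc, hx₁ _ (by
        rw [mul_add, add_left_comm]; exact I.add_mem hb hc), zero_add]
    · rw [hx₁ b hb, hx₀ c hc, hx₁ _ (by
        rw [mul_add, ← add_assoc]; exact I.add_mem hb hc), add_zero]
    · rw [hx₁ b hb, hx₁ c hc, hx₀ _ ?_]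
      · rfl
      · have := I.add_mem hb hc
        rwa [add_add_add_comm, h2, zero_add, ← mul_add] at this
  · exact hx₁ a (by rw [h, h2]; exact I.zero_mem)
  · exact hx₀ b (I.mul_mem_left _ _ (hJI hb))

end Idempotent

namespace StoneSpace

variable {R : Type*} [NonUnitalRing R]

theorem eq_zero_or_one (x : StoneSpace R) (a : R) : x.1 a = 0 ∨ x.1 a = 1 := by
  generalize x.1 a = z
  revert z
  decide

theorem mem_basic {a : R} {x : StoneSpace R} : x ∈ basic a ↔ x.1 a = 1 := Iff.rfl

theorem notMem_basic {a : R} {x : StoneSpace R} : x ∉ basic a ↔ x.1 a = 0 := by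
  rw [mem_basic]
  rcases eq_zero_or_one x a with h | h <;> simp [h]

theorem basic_zero : basic (0 : R) = ∅ :=
  Set.eq_empty_of_forall_notMem fun x => notMem_basic.2 (map_zero x.1)

theorem basic_mul (a b : R) : basic (a * b) = basic a ∩ basic b := by
  ext x
  rw [Set.mem_inter_iff, mem_basic, mem_basic, mem_basic, map_mul]
  rcases eq_zero_or_one x a with h | h <;> rcases eq_zero_or_one x b with k | k <;> simp [h, k]

theorem mem_basic_add {a b : R} {x : StoneSpace R} :
    x ∈ basic (a + b) ↔ Xor (x ∈ basic a) (x ∈ basic b) := by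
  have h2 : (1 : ZMod 2) + 1 = 0 := rfl
  rw [mem_basic, mem_basic, mem_basic, map_add]
  rcases eq_zero_or_one x a with h | h <;> rcases eq_zero_or_one x b with k | k <;>
    simp [h, k, h2, Xor]

theorem basic_add_add_mul (a b : R) : basic (a + b + a * b) = basic a ∪ basic b := by
  ext x
  rw [mem_basic_add, mem_basic_add, basic_mul]
  simp only [Xor, Set.mem_inter_iff, Set.mem_union]
  tauto

theorem basic_add_mul (a b : R) : basic (a + a * b) = basic a \ basic b := by
  ext x
  rw [mem_basic_add, basic_mul]
  simp only [Xor, Set.mem_inter_iff, Set.mem_sdiff]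
  tauto

theorem exists_mem_basic (x : StoneSpace R) : ∃ a, x ∈ basic a := by
  by_contra hn
  refine x.2 (NonUnitalRingHom.ext fun a => ?_)
  exact notMem_basic.1 fun h => hn ⟨a, h⟩

theorem isTopologicalBasis_basic : IsTopologicalBasis (Set.range (basic (R := R))) where
  exists_subset_inter := by
    rintro _ ⟨a, rfl⟩ _ ⟨b, rfl⟩ x hx
    exact ⟨_, ⟨a * b, rfl⟩, by rwa [basic_mul], (basic_mul a b).subset⟩
  sUnion_eq := Set.eq_univ_of_forall fun x => by
    obtain ⟨a, ha⟩ := exists_mem_basic x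
    exact ⟨_, ⟨a, rfl⟩, ha⟩
  eq_generateFrom := rfl

theorem isOpen_basic (a : R) : IsOpen (basic a) := isTopologicalBasis_basic.isOpen ⟨a, rfl⟩

theorem isCompact_basic (a : R) : IsCompact (basic a) := by
  classical
  rw [isCompact_iff_ultrafilter_le_nhds']
  intro 𝓤 ha
  -- the limit of `𝓤` takes the value `1` at `b` if and only if `basic b` belongs to `𝓤`
  let y : R →ₙ+* ZMod 2 :=
    { toFun := fun b => if basic b ∈ 𝓤 then 1 else 0
      map_mul' := fun b c => by
        have : basic (b * c) ∈ 𝓤 ↔ basic b ∈ 𝓤 ∧ basic c ∈ 𝓤 := by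
          rw [basic_mul]
          exact Filter.inter_mem_iff
        by_cases hb : basic b ∈ 𝓤 <;> by_cases hc : basic c ∈ 𝓤 <;> simp [this, hb, hc]
      map_zero' := by
        rw [basic_zero, if_neg (Ultrafilter.empty_notMem)]
      map_add' := fun b c => by
        have h2 : (1 : ZMod 2) + 1 = 0 := rfl
        have : basic (b + c) ∈ 𝓤 ↔ Xor (basic b ∈ 𝓤) (basic c ∈ 𝓤) := by
          have e : basic (b + c) = (basic b \ basic c) ∪ (basic c \ basic b) := by
            ext x; exact mem_basic_add
          rw [e, Ultrafilter.union_mem_iff, Set.sdiff_eq, Set.sdiff_eq]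
          refine or_congr (Filter.inter_mem_iff.trans ?_) (Filter.inter_mem_iff.trans ?_)
          · exact and_congr_right fun _ => Ultrafilter.compl_mem_iff_notMem
          · exact and_congr_right fun _ => Ultrafilter.compl_mem_iff_notMem
        by_cases hb : basic b ∈ 𝓤 <;> by_cases hc : basic c ∈ 𝓤 <;>
          simp [this, hb, hc, Xor, h2] }
  have hy : ∀ b, y b = 1 ↔ basic b ∈ 𝓤 := fun b => by
    change (if basic b ∈ 𝓤 then (1 : ZMod 2) else 0) = 1 ↔ _
    split_ifs with h <;> simp [h]
  have hya : y a = 1 := (hy a).2 ha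
  let y' : StoneSpace R := ⟨y, fun h0 => by
    rw [h0] at hya
    exact zero_ne_one hya⟩
  refine ⟨y', hya, ?_⟩
  rw [isTopologicalBasis_basic.nhds_hasBasis.ge_iff]
  rintro _ ⟨⟨b, rfl⟩, hb⟩
  exact (hy b).1 hb

instance : T2Space (StoneSpace R) := ⟨fun x y hxy => by
  have : ∃ a, ¬ (x ∈ basic a ↔ y ∈ basic a) := by
    by_contra hn
    refine hxy (Subtype.ext (NonUnitalRingHom.ext fun a => ?_))
    have hn' : x ∈ basic a ↔ y ∈ basic a := not_not.1 fun h => hn ⟨a, h⟩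
    by_cases h : x ∈ basic a
    · exact (mem_basic.1 h).trans (mem_basic.1 (hn'.1 h)).symm
    · exact (notMem_basic.1 h).trans (notMem_basic.1 fun k => h (hn'.2 k)).symm
  obtain ⟨a, ha⟩ := this
  have key : ∀ u v : StoneSpace R, u ∈ basic a → v ∉ basic a →
      ∃ U V : Set (StoneSpace R), IsOpen U ∧ IsOpen V ∧ u ∈ U ∧ v ∈ V ∧ Disjoint U V := by
    intro u v hu hv
    obtain ⟨b, hb⟩ := exists_mem_basic v
    refine ⟨basic a, basic (b + b * a), isOpen_basic _, isOpen_basic _, hu, ?_, ?_⟩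
    · rw [basic_add_mul]
      exact ⟨hb, hv⟩
    · rw [basic_add_mul]
      exact Set.disjoint_sdiff_right
  by_cases h : x ∈ basic a
  · exact key x y h fun k => ha (iff_of_true h k)
  · have k : y ∈ basic a := by
      by_contra k
      exact ha (iff_of_false h k)
    obtain ⟨U, V, h₁, h₂, h₃, h₄, h₅⟩ := key y x k h
    exact ⟨V, U, h₂, h₁, h₄, h₃, h₅.symm⟩⟩

/-- The elements of the ring give all the compact open sets. -/
theorem exists_eq_basic {V : Set (StoneSpace R)} (hV : IsCompact V) (hVo : IsOpen V) :
    ∃ a, V = basic a := by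
  have : ∃ a, V ⊆ basic a ∧ basic a ⊆ V := by
    refine hV.induction_on (p := fun s => ∃ a, s ⊆ basic a ∧ basic a ⊆ V) ?_ ?_ ?_ ?_
    · exact ⟨0, by simp, by simp [basic_zero]⟩
    · rintro s t hst ⟨a, h₁, h₂⟩
      exact ⟨a, hst.trans h₁, h₂⟩
    · rintro s t ⟨a, h₁, h₂⟩ ⟨b, h₃, h₄⟩
      refine ⟨a + b + a * b, ?_, ?_⟩ <;> rw [basic_add_add_mul]
      · exact Set.union_subset_union h₁ h₃
      · exact Set.union_subset h₂ h₄
    · intro x hx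
      obtain ⟨_, ⟨a, rfl⟩, h₃, h₄⟩ := isTopologicalBasis_basic.exists_subset_of_mem_open hx hVo
      exact ⟨basic a, mem_nhdsWithin_of_mem_nhds ((isOpen_basic a).mem_nhds h₃), a, subset_rfl, h₄⟩
  obtain ⟨a, h₁, h₂⟩ := this
  exact ⟨a, h₁.antisymm h₂⟩

theorem isTopologicalBasis_compactOpen :
    IsTopologicalBasis {U : Set (StoneSpace R) | IsCompact U ∧ IsOpen U} := by
  convert isTopologicalBasis_basic (R := R) using 1
  ext U
  constructor
  · rintro ⟨h₁, h₂⟩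
    obtain ⟨a, rfl⟩ := exists_eq_basic h₁ h₂
    exact ⟨a, rfl⟩
  · rintro ⟨a, rfl⟩
    exact ⟨isCompact_basic a, isOpen_basic a⟩

theorem isClosed_zeroLocus (J : TwoSidedIdeal R) : IsClosed (zeroLocus J) := by
  have : zeroLocus J = ⋂ a ∈ J, (basic a)ᶜ := by
    ext x
    simp only [Set.mem_iInter, Set.mem_compl_iff, notMem_basic]
    rfl
  rw [this]
  exact isClosed_biInter fun a _ => (isOpen_basic a).isClosed_compl

/-- An ideal is determined by its closed set. -/
theorem mem_ideal_iff (h : ∀ a : R, a * a = a) {J : TwoSidedIdeal R} {a : R} :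
    a ∈ J ↔ ∀ x ∈ zeroLocus J, x ∉ basic a := by
  refine ⟨fun ha x hx => notMem_basic.2 (hx a ha), fun hx => ?_⟩
  by_contra ha
  obtain ⟨x, h₁, h₂⟩ := exists_hom_of_notMem h J ha
  refine hx ⟨x, fun h0 => ?_⟩ h₂ h₁
  rw [h0] at h₁
  exact zero_ne_one h₁

theorem basic_injective (h : ∀ a : R, a * a = a) : Function.Injective (basic (R := R)) := by
  intro a b hab
  have : a + b ∈ (⊥ : TwoSidedIdeal R) := by
    rw [mem_ideal_iff h]
    intro x _ hx
    rw [mem_basic_add, hab] at hx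
    simp [Xor] at hx
  rw [TwoSidedIdeal.mem_bot] at this
  exact add_right_cancel (this.trans (add_self_of_idem h b).symm)

/-- The homeomorphism of Stone spaces induced by an isomorphism of rings. -/
def congr {R' : Type*} [NonUnitalRing R'] (φ : R ≃+* R') : StoneSpace R' ≃ₜ StoneSpace R where
  toFun x := ⟨x.1.comp (φ : R →ₙ+* R'), fun h0 => x.2 (NonUnitalRingHom.ext fun a => by
    have := DFunLike.congr_fun h0 (φ.symm a)
    simpa using this)⟩
  invFun x := ⟨x.1.comp (φ.symm : R' →ₙ+* R), fun h0 => x.2 (NonUnitalRingHom.ext fun a => by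
    have := DFunLike.congr_fun h0 (φ a)
    simpa using this)⟩
  left_inv x := Subtype.ext (NonUnitalRingHom.ext fun a => by simp)
  right_inv x := Subtype.ext (NonUnitalRingHom.ext fun a => by simp)
  continuous_toFun := continuous_generateFrom_iff.2 (by
    rintro _ ⟨a, rfl⟩
    exact isOpen_basic (φ a))
  continuous_invFun := continuous_generateFrom_iff.2 (by
    rintro _ ⟨a, rfl⟩
    exact isOpen_basic (φ.symm a))

theorem congr_mem_zeroLocus {R' : Type*} [NonUnitalRing R'] (φ : R ≃+* R') {J : TwoSidedIdeal R}
    {J' : TwoSidedIdeal R'} (h : ∀ a, a ∈ J ↔ φ a ∈ J') (x : StoneSpace R') :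
    congr φ x ∈ zeroLocus J ↔ x ∈ zeroLocus J' := by
  constructor
  · intro hx b hb
    have : x.1 (φ (φ.symm b)) = 0 := hx (φ.symm b) ((h _).2 (by simpa using hb))
    rwa [RingEquiv.apply_symm_apply] at this
  · exact fun hx a ha => hx (φ a) ((h a).1 ha)

end StoneSpace

/-! ### Isomorphisms between stratified systems -/

/-- The points of `X` whose membership in the sets `B p`, for `p` in the list `l`, is prescribed
by `ε`. -/
def cell {X I : Type*} (B : I → Set X) (l : List I) (ε : Set I) : Set X :=
  {x | ∀ p ∈ l, x ∈ B p ↔ p ∈ ε}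

section Cell

variable {X I : Type*} (B : I → Set X)

theorem mem_cell_self (l : List I) (x : X) : x ∈ cell B l {p | x ∈ B p} := fun _ _ => Iff.rfl

theorem cell_inter_mem (l : List I) (ε : Set I) : cell B l (ε ∩ {p | p ∈ l}) = cell B l ε := by
  ext x
  refine forall₂_congr fun p hp => iff_congr Iff.rfl ?_
  simp [hp]

theorem cell_cons_of_mem {l : List I} {ε : Set I} {p : I} (hp : p ∈ ε) :
    cell B (p :: l) ε = cell B l ε ∩ B p := by
  ext x
  simp [cell, hp, and_comm]

theorem cell_cons_of_notMem {l : List I} {ε : Set I} {p : I} (hp : p ∉ ε) :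
    cell B (p :: l) ε = cell B l ε \ B p := by
  ext x
  simp [cell, hp, and_comm]

theorem isClopen_cell [TopologicalSpace X] {B : I → Set X} (hB : ∀ p, IsClopen (B p)) (l : List I)
    (ε : Set I) : IsClopen (cell B l ε) := by
  induction l with
  | nil => simp [cell, isClopen_univ]
  | cons p l ih =>
    by_cases hp : p ∈ ε
    · rw [cell_cons_of_mem B hp]
      exact ih.inter (hB p)
    · rw [cell_cons_of_notMem B hp]
      rw [Set.sdiff_eq]
      exact ih.inter (hB p).compl

end Cell

section Matching

variable {X X' : Type*} [TopologicalSpace X] [TopologicalSpace X'] [T2Space X] [T2Space X']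
  {S : Type*} [PartialOrder S] [Finite S] {M F : Set S} {g : S → ℕ} {π : X → S} {π' : X' → S}

/-- The extension step of the back-and-forth argument, in all the cells at once. -/
theorem exists_matching_compactOpen {I : Type*} (h : IsStratification M F g π)
    (h' : IsStratification M F g π')
    (hX' : IsTopologicalBasis {U : Set X' | IsCompact U ∧ IsOpen U}) {B : I → Set X}
    {B' : I → Set X'} (hB : ∀ p, IsClopen (B p)) (hB' : ∀ p, IsClopen (B' p)) (l : List I)
    (inv : ∀ ε, SameInvariants π π' (cell B l ε) (cell B' l ε)) {V : Set X} (hV : IsCompact V)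
    (hVo : IsOpen V) :
    ∃ V', IsCompact V' ∧ IsOpen V' ∧ ∀ ε,
      SameInvariants π π' (cell B l ε ∩ V) (cell B' l ε ∩ V') ∧
      SameInvariants π π' (cell B l ε \ V) (cell B' l ε \ V') := by
  choose V' h₁ h₂ h₃ h₄ h₅ using fun ε => (inv ε).exists_extension h h' hX' (isClopen_cell hB l ε)
    (isClopen_cell hB' l ε).isOpen hV hVo
  -- the sets found in the cells are put together, one for each of the finitely many cells
  let E : Set (Set I) := {ε | ε ⊆ {p | p ∈ l}}
  have hE : E.Finite := (List.finite_toSet l).finite_subsets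
  have key : ∀ ε, cell B' l ε ∩ ⋃ η ∈ E, V' η = V' (ε ∩ {p | p ∈ l}) := fun ε => by
    ext x
    constructor
    · rintro ⟨hx, hx'⟩
      simp only [Set.mem_iUnion] at hx'
      obtain ⟨η, hη, hx'⟩ := hx'
      have : η = ε ∩ {p | p ∈ l} := by
        ext p
        constructor
        · exact fun hp => ⟨(hx p (hη hp)).1 ((h₁ η hx' p (hη hp)).2 hp), hη hp⟩
        · exact fun hp => (h₁ η hx' p hp.2).1 ((hx p hp.2).2 hp.1)
      exact this ▸ hx'
    · intro hx
      refine ⟨?_, Set.mem_biUnion (show ε ∩ {p | p ∈ l} ∈ E from Set.inter_subset_right) hx⟩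
      rw [← cell_inter_mem]
      exact h₁ _ hx
  refine ⟨⋃ η ∈ E, V' η, hE.isCompact_biUnion fun η _ => h₂ η, isOpen_biUnion fun η _ => h₃ η,
    fun ε => ⟨?_, ?_⟩⟩
  · rw [key, ← cell_inter_mem]
    exact h₄ _
  · rw [← Set.sdiff_self_inter (s := cell B' l ε), key, ← cell_inter_mem B l ε,
      ← cell_inter_mem B' l ε]
    exact h₅ _

end Matching

theorem SameInvariants.exists_mem {X X' : Type*} [TopologicalSpace X] [TopologicalSpace X']
    [T1Space X'] {S : Type*} [PartialOrder S] {M F : Set S} {g : S → ℕ} {π : X → S} {π' : X' → S}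
    (h' : IsStratification M F g π') {W : Set X} {W' : Set X'} (hW' : IsOpen W')
    (inv : SameInvariants π π' W W') {x : X} (hx : x ∈ W) : ∃ x' ∈ W', π' x' = π x := by
  rcases mem_isoSet_or π x with h | h
  · have : (isoSet π' (π x) ∩ W').Nonempty := by
      rw [← Set.encard_pos, ← (inv _).1, Set.encard_pos]
      exact ⟨x, h, hx⟩
    obtain ⟨y, hy, hyW⟩ := this
    exact ⟨y, hyW, hy.1⟩
  · obtain ⟨y, hy, hyW⟩ := (inv _).2.1.1 ⟨x, h, hx⟩
    obtain ⟨z, h₁, h₂, -, -⟩ := h'.exists_mem_accSet hy hW' hyW Set.finite_empty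
    exact ⟨z, h₁, h₂⟩

theorem IsStratification.sameInvariants_univ {X X' : Type*} [TopologicalSpace X]
    [TopologicalSpace X'] [T1Space X] [T1Space X'] {S : Type*} [PartialOrder S] {M F : Set S}
    {g : S → ℕ} {π : X → S} {π' : X' → S} (h : IsStratification M F g π)
    (h' : IsStratification M F g π') : SameInvariants π π' Set.univ Set.univ := by
  intro s
  simp only [Set.inter_univ]
  exact ⟨(h.encard_isolated s).trans (h'.encard_isolated s).symm,
    (h.accSet_nonempty_iff s).trans (h'.accSet_nonempty_iff s).symm,
    (h.isCompact_accSet_iff s).trans (h'.isCompact_accSet_iff s).symm⟩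

/-- The Stone space of the system `A` is stratified by the poset of the tuple `T`, with the
invariants of `T`, in such a way that the closed set of the `i`-th distinguished ideal is the union
of the strata in `Q i`. -/
structure IsStratifiedBy {n : ℕ} (A : IdealSystem.{u} n) (T : PosetTuple.{v} n)
    (π : StoneSpace A.carrier → T.S) : Prop where
  strat : IsStratification T.M T.F T.g π
  zeroLocus_eq : ∀ i, StoneSpace.zeroLocus (A.J i) = π ⁻¹' T.Q i

open StoneSpace

/-- Tuples of elements of two systems stratified by the same tuple are matched by an isomorphism
as soon as the cells into which they divide the Stone spaces have the same invariants. -/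
theorem IsStratifiedBy.exists_iso {n : ℕ} {A : IdealSystem.{u} n} {A' : IdealSystem.{u} n}
    [Countable A.carrier] [Countable A'.carrier] {T : PosetTuple.{v} n}
    {π : StoneSpace A.carrier → T.S} {π' : StoneSpace A'.carrier → T.S}
    (h : IsStratifiedBy A T π) (h' : IsStratifiedBy A' T π')
    (l₀ : List (A.carrier × A'.carrier))
    (inv : ∀ ε, SameInvariants π π' (cell (fun p => basic p.1) l₀ ε)
      (cell (fun p => basic p.2) l₀ ε)) :
    ∃ φ : A.carrier ≃+* A'.carrier, (∀ i a, a ∈ A.J i ↔ φ a ∈ A'.J i) ∧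
      ∀ p ∈ l₀, φ p.1 = p.2 := by
  have hB : ∀ p : A.carrier × A'.carrier, IsClopen (basic p.1) := fun p =>
    ⟨(isCompact_basic _).isClosed, isOpen_basic _⟩
  have hB' : ∀ p : A.carrier × A'.carrier, IsClopen (basic p.2) := fun p =>
    ⟨(isCompact_basic _).isClosed, isOpen_basic _⟩
  let P : List (A.carrier × A'.carrier) → Prop := fun l => ∀ ε, SameInvariants π π'
    (cell (fun p => basic p.1) l ε) (cell (fun p => basic p.2) l ε)
  have fwd : ∀ l, P l → ∀ x, ∃ x', π' x' = π x ∧ ∀ p ∈ l, x ∈ basic p.1 ↔ x' ∈ basic p.2 := by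
    intro l hl x
    obtain ⟨x', hx', hπ⟩ := (hl _).exists_mem h'.strat (isClopen_cell hB' l _).isOpen
      (mem_cell_self (fun p : A.carrier × A'.carrier => basic p.1) l x)
    exact ⟨x', hπ, fun p hp => (hx' p hp).symm⟩
  have bwd : ∀ l, P l → ∀ x', ∃ x, π x = π' x' ∧ ∀ p ∈ l, x ∈ basic p.1 ↔ x' ∈ basic p.2 := by
    intro l hl x'
    obtain ⟨x, hx, hπ⟩ := (hl _).symm.exists_mem h.strat (isClopen_cell hB l _).isOpen
      (mem_cell_self (fun p : A.carrier × A'.carrier => basic p.2) l x')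
    exact ⟨x, hπ, fun p hp => hx p hp⟩
  have hinj : ∀ l, P l → ∀ p ∈ l, ∀ q ∈ l, p.1 = q.1 ↔ p.2 = q.2 := by
    intro l hl p hp q hq
    constructor
    · intro hpq
      refine basic_injective A'.idem (Set.ext fun x' => ?_)
      obtain ⟨x, -, hx⟩ := bwd l hl x'
      rw [← hx p hp, ← hx q hq, hpq]
    · intro hpq
      refine basic_injective A.idem (Set.ext fun x => ?_)
      obtain ⟨x', -, hx⟩ := fwd l hl x
      rw [hx p hp, hx q hq, hpq]
  have hcons : ∀ l a b, (∀ ε,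
      SameInvariants π π' (cell (fun p => basic p.1) l ε ∩ basic a)
        (cell (fun p => basic p.2) l ε ∩ basic b) ∧
      SameInvariants π π' (cell (fun p => basic p.1) l ε \ basic a)
        (cell (fun p => basic p.2) l ε \ basic b)) → P ((a, b) :: l) := by
    intro l a b hab ε
    by_cases hε : (a, b) ∈ ε
    · rw [cell_cons_of_mem _ hε, cell_cons_of_mem _ hε]
      exact (hab ε).1
    · rw [cell_cons_of_notMem _ hε, cell_cons_of_notMem _ hε]
      exact (hab ε).2
  obtain ⟨f, hf⟩ := exists_equiv_of_backAndForth P hinj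
    (by
      intro l a hl
      obtain ⟨V', h₁, h₂, h₃⟩ := exists_matching_compactOpen h.strat h'.strat
        isTopologicalBasis_compactOpen hB hB' l hl (isCompact_basic a) (isOpen_basic a)
      obtain ⟨b, rfl⟩ := exists_eq_basic h₁ h₂
      exact ⟨b, hcons l a b h₃⟩)
    (by
      intro l b hl
      obtain ⟨V, h₁, h₂, h₃⟩ := exists_matching_compactOpen h'.strat h.strat
        isTopologicalBasis_compactOpen hB' hB l (fun ε => (hl ε).symm) (isCompact_basic b)
        (isOpen_basic b)
      obtain ⟨a, rfl⟩ := exists_eq_basic h₁ h₂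
      exact ⟨a, hcons l a b fun ε => ⟨(h₃ ε).1.symm, (h₃ ε).2.symm⟩⟩)
    l₀ inv
  classical
  let φ : A.carrier ≃+* A'.carrier :=
    { f with
      map_mul' := fun a b => by
        obtain ⟨l, hl, -, hs⟩ := hf {a, b, a * b}
        refine basic_injective A'.idem (Set.ext fun x' => ?_)
        obtain ⟨x, -, hx⟩ := bwd l hl x'
        change x' ∈ basic (f (a * b)) ↔ x' ∈ basic (f a * f b)
        rw [basic_mul, Set.mem_inter_iff, ← hx _ (hs a (by simp)), ← hx _ (hs b (by simp)),
          ← hx _ (hs (a * b) (by simp)), ← Set.mem_inter_iff, ← basic_mul]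
      map_add' := fun a b => by
        obtain ⟨l, hl, -, hs⟩ := hf {a, b, a + b}
        refine basic_injective A'.idem (Set.ext fun x' => ?_)
        obtain ⟨x, -, hx⟩ := bwd l hl x'
        change x' ∈ basic (f (a + b)) ↔ x' ∈ basic (f a + f b)
        rw [mem_basic_add, ← hx _ (hs a (by simp)), ← hx _ (hs b (by simp)),
          ← hx _ (hs (a + b) (by simp)), ← mem_basic_add] }
  refine ⟨φ, fun i a => ?_, fun p hp => ?_⟩
  · obtain ⟨l, hl, -, hs⟩ := hf {a}
    have ha := hs a (by simp)
    rw [mem_ideal_iff A.idem, mem_ideal_iff A'.idem, h.zeroLocus_eq, h'.zeroLocus_eq]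
    constructor
    · intro hx x' hx' hxa
      obtain ⟨x, hπ, hm⟩ := bwd l hl x'
      refine hx x ?_ ((hm _ ha).2 hxa)
      rw [Set.mem_preimage, hπ]
      exact hx'
    · intro hx' x hx hxa
      obtain ⟨x', hπ, hm⟩ := fwd l hl x
      refine hx' x' ?_ ((hm _ ha).1 hxa)
      rw [Set.mem_preimage, hπ]
      exact hx
  · obtain ⟨l, hl, hl₀, hs⟩ := hf {p.1}
    exact (hinj l hl _ (hs p.1 (by simp)) _ (hl₀ hp)).1 rfl

/-- The invariants determine a countable system up to isomorphism. -/
theorem IsStratifiedBy.iso {n : ℕ} {A : IdealSystem.{u} n} {A' : IdealSystem.{u} n}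
    [Countable A.carrier] [Countable A'.carrier] {T : PosetTuple.{v} n}
    {π : StoneSpace A.carrier → T.S} {π' : StoneSpace A'.carrier → T.S}
    (h : IsStratifiedBy A T π) (h' : IsStratifiedBy A' T π') : A.Iso A' := by
  obtain ⟨φ, hφ, -⟩ := h.exists_iso h' [] fun ε => by
    simpa [cell] using h.strat.sameInvariants_univ h'.strat
  exact ⟨φ, hφ⟩

/-! ### Stratified systems are `ω`-categorical -/

instance instCountableSymbols (n : ℕ) : Countable (idealLang n).Symbols := by
  have h₁ : Countable (Σ l, RingFun l) := by
    refine Function.Surjective.countable (α := Fin 3)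
      (f := ![⟨0, .zero⟩, ⟨2, .add⟩, ⟨2, .mul⟩]) ?_
    rintro ⟨_, (_ | _ | _)⟩
    exacts [⟨0, rfl⟩, ⟨1, rfl⟩, ⟨2, rfl⟩]
  have h₂ : Countable (Σ l, IdealRel n l) := by
    refine Function.Surjective.countable (α := Fin n) (f := fun i => ⟨1, .ideal i⟩) ?_
    rintro ⟨_, ⟨i⟩⟩
    exact ⟨i, rfl⟩
  exact inferInstanceAs (Countable ((Σ l, RingFun l) ⊕ (Σ l, IdealRel n l)))

/-- A ring isomorphism which preserves the distinguished ideals, as an isomorphism of first-order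
structures. -/
def languageEquiv {n : ℕ} {A B : IdealSystem.{u} n} (φ : A.carrier ≃+* B.carrier)
    (h : ∀ i a, a ∈ A.J i ↔ φ a ∈ B.J i) :
    FirstOrder.Language.Equiv (idealLang n) A.carrier B.carrier where
  toEquiv := φ.toEquiv
  map_fun' f x := by
    rcases f with _ | _ | _
    exacts [map_zero φ, map_add φ _ _, map_mul φ _ _]
  map_rel' r x := by
    rcases r with ⟨i⟩
    exact (h i _).symm

theorem exists_ringEquiv_of_languageEquiv {n : ℕ} {A B : IdealSystem.{u} n}
    (f : FirstOrder.Language.Equiv (idealLang n) A.carrier B.carrier) :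
    ∃ φ : A.carrier ≃+* B.carrier, (∀ a, φ a = f a) ∧ ∀ i a, a ∈ A.J i ↔ φ a ∈ B.J i := by
  refine ⟨{ f.toEquiv with
    map_mul' := fun a b => f.map_fun' (n := 2) RingFun.mul ![a, b]
    map_add' := fun a b => f.map_fun' (n := 2) RingFun.add ![a, b] }, fun a => rfl, fun i a => ?_⟩
  exact (f.map_rel' (n := 1) (IdealRel.ideal i) ![a]).symm

/-- The cells of a tuple have only finitely many possible invariants, and tuples with the same
invariants are conjugate. -/
theorem IsStratifiedBy.omegaCategorical {n : ℕ} {A : IdealSystem.{u} n} [Countable A.carrier]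
    {T : PosetTuple.{v} n} {π : StoneSpace A.carrier → T.S} (h : IsStratifiedBy A T π) :
    OmegaCategorical (idealLang n) A.carrier := by
  refine (finitelyManyTypes_of_orbits fun k => ?_).omegaCategorical
  let W : (Fin k → A.carrier) → Set (Fin k) → Set (StoneSpace A.carrier) := fun v δ =>
    {x | ∀ i, x ∈ basic (v i) ↔ i ∈ δ}
  have hfin : ∀ s, Finite (Set.Iic (T.g s : ℕ∞)) := fun s => by
    refine ((Set.finite_Iic (T.g s)).image (Nat.cast : ℕ → ℕ∞)).subset fun m hm => ?_
    obtain ⟨m, rfl⟩ := ENat.ne_top_iff_exists.1 (ne_top_of_le_ne_top (ENat.natCast_ne_top _) hm)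
    exact ⟨m, by simpa using hm, rfl⟩
  refine ⟨Set (Fin k) → ∀ s : T.S, Set.Iic (T.g s : ℕ∞) × Prop × Prop, inferInstance,
    fun v δ s => ⟨⟨(isoSet π s ∩ W v δ).encard, ?_⟩, (accSet π s ∩ W v δ).Nonempty,
      IsCompact (accSet π s ∩ W v δ)⟩, fun v w hvw => ?_⟩
  · exact (Set.encard_le_encard Set.inter_subset_left).trans (h.strat.encard_isolated s).le
  · obtain ⟨φ, hφ, hφ'⟩ := h.exists_iso h (List.ofFn fun i => (v i, w i)) fun ε s => by
      have h₁ : cell (fun p : A.carrier × A.carrier => basic p.1)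
          (List.ofFn fun i => (v i, w i)) ε = W v {i | (v i, w i) ∈ ε} := by
        ext x
        simp [cell, W, List.mem_ofFn']
      have h₂ : cell (fun p : A.carrier × A.carrier => basic p.2)
          (List.ofFn fun i => (v i, w i)) ε = W w {i | (v i, w i) ∈ ε} := by
        ext x
        simp [cell, W, List.mem_ofFn']
      rw [h₁, h₂]
      have := congrFun (congrFun hvw {i | (v i, w i) ∈ ε}) s
      simp only [Prod.mk.injEq, eq_iff_iff] at this
      exact ⟨congrArg Subtype.val this.1, this.2⟩
    exact ⟨languageEquiv φ hφ, fun i => hφ' _ ((List.mem_ofFn' _ _).2 ⟨i, rfl⟩)⟩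

/-! ### Closure algebras -/

section ClosureAlg

variable {X : Type u} {cl : Set X → Set X} {G : Set (Set X)}

theorem mem_closureAlg_of_mem {s : Set X} (hs : s ∈ G) : s ∈ closureAlg cl G :=
  BooleanSubalgebra.mem_sInf.2 fun _ hB => hB.1 hs

theorem cl_mem_closureAlg {s : Set X} (hs : s ∈ closureAlg cl G) : cl s ∈ closureAlg cl G :=
  BooleanSubalgebra.mem_sInf.2 fun B hB => hB.2 s (BooleanSubalgebra.mem_sInf.1 hs B hB)

theorem closureAlg_induction {p : Set X → Prop} (hG : ∀ s ∈ G, p s)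
    (hcl : ∀ s, s ∈ closureAlg cl G → p s → p (cl s)) (hbot : p ∅)
    (hcompl : ∀ s, p s → p sᶜ) (hsup : ∀ s t, p s → p t → p (s ∪ t))
    {s : Set X} (hs : s ∈ closureAlg cl G) : p s := by
  let B : BooleanSubalgebra (Set X) :=
    { carrier := {s | s ∈ closureAlg cl G ∧ p s}
      supClosed' := fun s hs t ht => ⟨BooleanSubalgebra.sup_mem hs.1 ht.1, hsup s t hs.2 ht.2⟩
      infClosed' := fun s hs t ht => ⟨BooleanSubalgebra.inf_mem hs.1 ht.1, by
        have := hcompl _ (hsup _ _ (hcompl s hs.2) (hcompl t ht.2))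
        rwa [← Set.compl_inter, compl_compl] at this⟩
      compl_mem' := fun {s} hs => ⟨BooleanSubalgebra.compl_mem hs.1, hcompl s hs.2⟩
      bot_mem' := ⟨BooleanSubalgebra.bot_mem, hbot⟩ }
  have hB : B ∈ {B : BooleanSubalgebra (Set X) | G ⊆ B ∧ ∀ s ∈ B, cl s ∈ B} :=
    ⟨fun s hs => ⟨mem_closureAlg_of_mem hs, hG s hs⟩,
      fun s hs => ⟨cl_mem_closureAlg hs.1, hcl s hs.1 hs.2⟩⟩
  exact (BooleanSubalgebra.mem_sInf.1 hs B hB).2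

theorem biUnion_mem_closureAlg {ι : Type*} {E : Set ι} (hE : E.Finite) {f : ι → Set X}
    (hf : ∀ i ∈ E, f i ∈ closureAlg cl G) : ⋃ i ∈ E, f i ∈ closureAlg cl G := by
  induction E, hE using Set.Finite.induction_on with
  | empty => simpa using (BooleanSubalgebra.bot_mem : (⊥ : Set X) ∈ closureAlg cl G)
  | insert _ _ ih =>
    rw [Set.biUnion_insert]
    exact BooleanSubalgebra.sup_mem (hf _ (Set.mem_insert _ _)) 
      (ih fun i hi => hf i (Set.mem_insert_of_mem _ hi))

theorem biInter_mem_closureAlg {ι : Type*} {E : Set ι} (hE : E.Finite) {f : ι → Set X}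
    (hf : ∀ i ∈ E, f i ∈ closureAlg cl G) : ⋂ i ∈ E, f i ∈ closureAlg cl G := by
  have := BooleanSubalgebra.compl_mem
    (biUnion_mem_closureAlg hE fun i hi => BooleanSubalgebra.compl_mem (hf i hi))
  simpa using this

theorem exists_eq_preimage_of_mem_closureAlg {S : Type v} {cl' : Set S → Set S} {G' : Set (Set S)}
    {π : X → S} (hG : ∀ D ∈ G, ∃ B ∈ G', D = π ⁻¹' B) (hcl : ∀ B, cl (π ⁻¹' B) = π ⁻¹' cl' B)
    {D : Set X} (hD : D ∈ closureAlg cl G) : ∃ B ∈ closureAlg cl' G', D = π ⁻¹' B := by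
  refine closureAlg_induction (cl := cl) (G := G)
    (p := fun D => ∃ B ∈ closureAlg cl' G', D = π ⁻¹' B) ?_ ?_ ?_ ?_ ?_ hD
  · intro D hD
    obtain ⟨B, hB, rfl⟩ := hG D hD
    exact ⟨B, mem_closureAlg_of_mem hB, rfl⟩
  · rintro _ - ⟨B, hB, rfl⟩
    exact ⟨_, cl_mem_closureAlg hB, hcl B⟩
  · exact ⟨∅, BooleanSubalgebra.bot_mem, rfl⟩
  · rintro _ ⟨B, hB, rfl⟩
    exact ⟨Bᶜ, BooleanSubalgebra.compl_mem hB, rfl⟩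
  · rintro _ _ ⟨B, hB, rfl⟩ ⟨B', hB', rfl⟩
    exact ⟨B ∪ B', BooleanSubalgebra.sup_mem hB hB', rfl⟩

end ClosureAlg

/-! ### Transport of stratifications -/

theorem derivedSet_preimage_subset {X Y : Type*} [TopologicalSpace X] [TopologicalSpace Y]
    (h : X ≃ₜ Y) (A : Set Y) : derivedSet (h ⁻¹' A) ⊆ h ⁻¹' derivedSet A := fun x hx => by
  have := AccPt.map hx h.continuous.continuousAt h.injective
  rwa [Filter.map_principal, Set.image_preimage_eq _ h.surjective] at this

theorem derivedSet_preimage_homeomorph {X Y : Type*} [TopologicalSpace X] [TopologicalSpace Y]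
    (h : X ≃ₜ Y) (A : Set Y) : derivedSet (h ⁻¹' A) = h ⁻¹' derivedSet A := by
  refine (derivedSet_preimage_subset h A).antisymm fun x hx => ?_
  have := derivedSet_preimage_subset h.symm (h ⁻¹' A)
  rw [← Set.preimage_comp, h.self_comp_symm, Set.preimage_id] at this
  simpa using this hx

theorem IsStratification.comp_homeomorph {X Y : Type*} [TopologicalSpace X] [TopologicalSpace Y]
    {S : Type*} [PartialOrder S] {M F : Set S} {g : S → ℕ} {π : Y → S}
    (hπ : IsStratification M F g π) (h : X ≃ₜ Y) : IsStratification M F g (π ∘ h) where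
  surjective := hπ.surjective.comp h.surjective
  closure_fiber s := by
    rw [Set.preimage_comp, ← h.preimage_closure, hπ.closure_fiber, Set.preimage_comp]
  mem_M s := by
    rw [hπ.mem_M, Set.preimage_comp, ← h.preimage_closure, h.isCompact_preimage]
  mem_F s := by
    rw [hπ.mem_F, Set.preimage_comp]
    exact ⟨fun hf => hf.preimage h.injective.injOn, fun hf => by
      simpa [Set.image_preimage_eq _ h.surjective] using hf.image h⟩
  encard_isolated s := by
    rw [Set.preimage_comp, derivedSet_preimage_homeomorph, ← Set.preimage_sdiff,
      ← hπ.encard_isolated s]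
    rw [← h.injective.encard_image, Set.image_preimage_eq _ h.surjective]

theorem IsStratification.comp_orderIso {X : Type*} [TopologicalSpace X] {S T : Type*}
    [PartialOrder S] [PartialOrder T] {M F : Set S} {g : S → ℕ} {π : X → S}
    (hπ : IsStratification M F g π) (θ : S ≃o T) {M' F' : Set T} {g' : T → ℕ}
    (hM : ∀ s, s ∈ M ↔ θ s ∈ M') (hF : ∀ s, s ∈ F ↔ θ s ∈ F') (hg : ∀ s, g' (θ s) = g s) :
    IsStratification M' F' g' (θ ∘ π) := by
  have fib : ∀ s, (θ ∘ π) ⁻¹' {θ s} = π ⁻¹' {s} := fun s => by ext x; simp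
  refine ⟨θ.surjective.comp hπ.surjective, fun t => ?_, fun t => ?_, fun t => ?_, fun t => ?_⟩ <;>
    obtain ⟨s, rfl⟩ := θ.surjective t
  · rw [fib, hπ.closure_fiber]
    ext x
    simp
  · rw [fib, ← hM, hπ.mem_M]
  · rw [fib, ← hF, hπ.mem_F]
  · rw [fib, hg, hπ.encard_isolated]

theorem IsStratifiedBy.of_iso_left {n : ℕ} {A A' : IdealSystem.{u} n} {T : PosetTuple.{v} n}
    {π : StoneSpace A.carrier → T.S} (h : IsStratifiedBy A T π) (hA : A.Iso A') :
    ∃ π' : StoneSpace A'.carrier → T.S, IsStratifiedBy A' T π' := by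
  obtain ⟨φ, hφ⟩ := hA
  refine ⟨π ∘ StoneSpace.congr φ, h.strat.comp_homeomorph _, fun i => ?_⟩
  ext x
  rw [← StoneSpace.congr_mem_zeroLocus φ (hφ i), h.zeroLocus_eq]
  rfl

theorem IsStratifiedBy.of_iso_right {n : ℕ} {A : IdealSystem.{u} n} {T T' : PosetTuple.{v} n}
    {π : StoneSpace A.carrier → T.S} (h : IsStratifiedBy A T π) (hT : T.Iso T') :
    ∃ π' : StoneSpace A.carrier → T'.S, IsStratifiedBy A T' π' := by
  obtain ⟨θ, hM, hF, hQ, hg⟩ := hT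
  refine ⟨θ ∘ π, h.strat.comp_orderIso θ hM hF hg, fun i => ?_⟩
  ext x
  rw [h.zeroLocus_eq, Set.mem_preimage, Set.mem_preimage]
  exact hQ i _

/-! ### The tuple of a stratified system -/

theorem closure_preimage_of_closure_fiber {X : Type*} [TopologicalSpace X] {S : Type*}
    [PartialOrder S] [Finite S] {π : X → S} (hπ : ∀ s, closure (π ⁻¹' {s}) = π ⁻¹' Set.Iic s)
    (B : Set S) : closure (π ⁻¹' B) = π ⁻¹' (lowerClosure B : Set S) := by
  have : π ⁻¹' B = ⋃ s ∈ B, π ⁻¹' {s} := by ext x; simp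
  rw [this, (Set.toFinite B).closure_biUnion]
  ext x
  simp [hπ]

/-- The closure algebra of a stratified Stone space consists of the unions of strata. -/
theorem IsStratifiedBy.mem_stoneAlg_iff {n : ℕ} {A : IdealSystem.{u} n} {T : PosetTuple.{v} n}
    {π : StoneSpace A.carrier → T.S} (h : IsStratifiedBy A T π) (D : Set (StoneSpace A.carrier)) :
    D ∈ A.stoneAlg ↔ ∃ B, D = π ⁻¹' B := by
  constructor
  · intro hD
    obtain ⟨B, -, hB⟩ := exists_eq_preimage_of_mem_closureAlg
      (cl' := fun s => (lowerClosure s : Set T.S)) (G' := Set.range T.Q)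
      (by
        rintro _ ⟨i, rfl⟩
        exact ⟨_, ⟨i, rfl⟩, h.zeroLocus_eq i⟩)
      (closure_preimage_of_closure_fiber h.strat.closure_fiber) hD
    exact ⟨B, hB⟩
  · rintro ⟨B, rfl⟩
    have hB : B ∈ closureAlg (fun s => (lowerClosure s : Set T.S)) (Set.range T.Q) := by
      rw [T.generates]
      exact BooleanSubalgebra.mem_top
    refine closureAlg_induction (p := fun B => π ⁻¹' B ∈ A.stoneAlg) ?_ (fun B _ ih => ?_)
      BooleanSubalgebra.bot_mem (fun B ih => BooleanSubalgebra.compl_mem ih)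
      (fun B B' ih ih' => BooleanSubalgebra.sup_mem ih ih') hB
    · rintro _ ⟨i, rfl⟩
      rw [← h.zeroLocus_eq]
      exact mem_closureAlg_of_mem ⟨i, rfl⟩
    · rw [← closure_preimage_of_closure_fiber h.strat.closure_fiber]
      exact cl_mem_closureAlg ih

theorem IsStratifiedBy.isTupleOf {n : ℕ} {A : IdealSystem.{u} n} {T : PosetTuple.{v} n}
    {π : StoneSpace A.carrier → T.S} (h : IsStratifiedBy A T π) : IsTupleOf A T := by
  let f : T.S → A.stoneAlg := fun s => ⟨π ⁻¹' {s}, (h.mem_stoneAlg_iff _).2 ⟨_, rfl⟩⟩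
  have hne : ∀ s, (π ⁻¹' {s}).Nonempty := fun s => by
    obtain ⟨x, hx⟩ := h.strat.surjective s
    exact ⟨x, hx⟩
  have hf : ∀ s, IsAtom (f s) := fun s => by
    refine ⟨fun h0 => ?_, fun D hD => ?_⟩
    · have : π ⁻¹' {s} = ∅ := congrArg Subtype.val h0
      exact (hne s).ne_empty this
    · obtain ⟨D, hDmem⟩ := D
      obtain ⟨B, rfl⟩ := (h.mem_stoneAlg_iff D).1 hDmem
      have hlt : π ⁻¹' B ⊂ π ⁻¹' {s} := hD
      refine Subtype.ext (Set.eq_empty_of_forall_notMem fun x hx => hlt.2 fun y hy => ?_)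
      have h₁ : π x = s := hlt.1 hx
      have h₂ : π y = s := hy
      rw [Set.mem_preimage, h₂, ← h₁]
      exact hx
  have hbij : Function.Bijective fun s => (⟨f s, hf s⟩ : {B : A.stoneAlg // IsAtom B}) := by
    constructor
    · intro s t hst
      obtain ⟨x, hx⟩ := hne s
      have : π ⁻¹' {s} = π ⁻¹' {t} := congrArg (fun B => (B.1.1 : Set _)) hst
      have h₂ : x ∈ π ⁻¹' {t} := this ▸ hx
      exact (show π x = s from hx).symm.trans h₂
    · rintro ⟨⟨D, hDmem⟩, hD⟩
      obtain ⟨B, rfl⟩ := (h.mem_stoneAlg_iff D).1 hDmem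
      have : (π ⁻¹' B).Nonempty := Set.nonempty_iff_ne_empty.2 fun h0 => hD.1 (Subtype.ext h0)
      obtain ⟨x, hx⟩ := this
      refine ⟨π x, Subtype.ext ?_⟩
      refine (hD.le_iff.1 ?_).resolve_left (hf (π x)).1
      intro y hy
      change π y ∈ B
      rw [show π y = π x from hy]
      exact hx
  refine ⟨Equiv.ofBijective _ hbij, ?_⟩
  refine ⟨fun s t => ?_, fun s => h.strat.mem_M s, fun s => h.strat.mem_F s,
    fun s => h.strat.encard_isolated s, fun i s => ?_⟩
  · change s ≤ t ↔ π ⁻¹' {s} ⊆ closure (π ⁻¹' {t})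
    rw [h.strat.closure_fiber]
    constructor
    · intro hst x hx
      exact (show π x = s from hx).trans_le hst
    · intro hst
      obtain ⟨x, hx⟩ := hne s
      exact (show π x = s from hx) ▸ hst hx
  · change s ∈ T.Q i ↔ π ⁻¹' {s} ⊆ StoneSpace.zeroLocus (A.J i)
    rw [h.zeroLocus_eq]
    constructor
    · intro hs x hx
      change π x ∈ T.Q i
      rwa [show π x = s from hx]
    · intro hs
      obtain ⟨x, hx⟩ := hne s
      exact (show π x = s from hx) ▸ hs hx

theorem IsTupleOf.iso {n : ℕ} {A : IdealSystem.{u} n} {T T' : PosetTuple.{v} n}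
    (h : IsTupleOf A T) (h' : IsTupleOf A T') : T.Iso T' := by
  obtain ⟨e, h₁, h₂, h₃, h₄, h₅⟩ := h
  obtain ⟨e', h₁', h₂', h₃', h₄', h₅'⟩ := h'
  dsimp only at h₁ h₂ h₃ h₄ h₅ h₁' h₂' h₃' h₄' h₅'
  have he : ∀ s, e' ((e.trans e'.symm) s) = e s := fun s => by simp
  refine ⟨⟨e.trans e'.symm, fun {s t} => ?_⟩, fun s => ?_, fun s => ?_, fun i s => ?_, fun s => ?_⟩
  · rw [h₁, h₁', he, he]
  · rw [h₂, h₂', RelIso.coe_fn_mk, he]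
  · rw [h₃, h₃', RelIso.coe_fn_mk, he]
  · rw [h₅, h₅', RelIso.coe_fn_mk, he]
  · rw [← ENat.natCast_inj, ← h₄, ← h₄', RelIso.coe_fn_mk, he]

/-! ### `ω`-categorical systems are stratified -/

section Automorphisms

variable {n : ℕ} {A : IdealSystem.{u} n}

theorem preimage_congr_of_mem_stoneAlg (φ : A.carrier ≃+* A.carrier)
    (hφ : ∀ i a, a ∈ A.J i ↔ φ a ∈ A.J i) {D : Set (StoneSpace A.carrier)} (hD : D ∈ A.stoneAlg) :
    StoneSpace.congr φ ⁻¹' D = D := by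
  refine closureAlg_induction (p := fun D => StoneSpace.congr φ ⁻¹' D = D) ?_
    (fun D _ ih => ?_) rfl (fun D ih => ?_) (fun D D' ih ih' => ?_) hD
  · rintro _ ⟨i, rfl⟩
    exact Set.ext fun x => congr_mem_zeroLocus φ (hφ i) x
  · rw [Homeomorph.preimage_closure, ih]
  · rw [Set.preimage_compl, ih]
  · rw [Set.preimage_union, ih, ih']

/-- An `ω`-categorical system has finitely many orbits of elements under its automorphisms. -/
theorem exists_coloring (hA : OmegaCategorical (idealLang n) A.carrier) :
    ∃ (κ : Type) (_ : Finite κ) (c : A.carrier → κ), ∀ a b, c a = c b →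
      ∃ φ : A.carrier ≃+* A.carrier, (∀ i a, a ∈ A.J i ↔ φ a ∈ A.J i) ∧ φ a = b := by
  have : Countable A.carrier := hA.1
  have : Nonempty A.carrier := ⟨0⟩
  obtain ⟨κ, hκ, c, hc⟩ := hA.finitelyManyTypes.exists_orbit_coloring
  refine ⟨κ, hκ, c, fun a b hab => ?_⟩
  obtain ⟨f, hf⟩ := hc a b hab
  obtain ⟨φ, hφ, hφ'⟩ := exists_ringEquiv_of_languageEquiv f
  exact ⟨φ, hφ', by rw [hφ, hf]⟩

/-- The closed members of the closure algebra are finite in number: each is determined by the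
automorphism-invariant ideal of the compact open sets that it misses. -/
theorem finite_closed_stoneAlg (hA : OmegaCategorical (idealLang n) A.carrier) :
    {C | C ∈ A.stoneAlg ∧ IsClosed C}.Finite := by
  obtain ⟨κ, _, c, hc⟩ := exists_coloring hA
  refine Set.Finite.of_injOn (f := fun C => c '' {a | Disjoint (basic a) C}) (t := Set.univ)
    (fun _ _ => trivial) ?_ Set.finite_univ
  have key : ∀ C, C ∈ A.stoneAlg ∧ IsClosed C → ∀ a,
      c a ∈ c '' {a | Disjoint (basic a) C} ↔ Disjoint (basic a) C := by
    rintro C ⟨hC, -⟩ a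
    refine ⟨?_, fun h => ⟨a, h, rfl⟩⟩
    rintro ⟨b, hb, hba⟩
    obtain ⟨φ, hφ, rfl⟩ := hc b a hba
    have hb' : Disjoint (basic b) C := hb
    rw [← preimage_congr_of_mem_stoneAlg φ hφ hC]
    exact hb'.preimage (StoneSpace.congr φ)
  have det : ∀ C D, C ∈ A.stoneAlg ∧ IsClosed C → D ∈ A.stoneAlg ∧ IsClosed D →
      c '' {a | Disjoint (basic a) C} = c '' {a | Disjoint (basic a) D} → C ⊆ D := by
    intro C D hC hD h x hx
    by_contra hn
    obtain ⟨_, ⟨a, rfl⟩, hxa, ha⟩ := isTopologicalBasis_basic.exists_subset_of_mem_open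
      (show x ∈ Dᶜ from hn) hD.2.isOpen_compl
    have h₁ := (key D hD a).2 (Set.disjoint_left.2 ha)
    rw [← h] at h₁
    exact Set.disjoint_left.1 ((key C hC a).1 h₁) hxa hx
  exact fun C hC D hD h => (det C D hC hD h).antisymm (det D C hD hC h.symm)

/-- A member of the closure algebra has finitely many isolated points. Otherwise there would be
compact open sets that contain exactly `k` of them, for every `k`, and these would lie in different
orbits of automorphisms. -/
theorem finite_isolated_of_mem_stoneAlg (hA : OmegaCategorical (idealLang n) A.carrier)
    {D : Set (StoneSpace A.carrier)} (hD : D ∈ A.stoneAlg) : (D \ derivedSet D).Finite := by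
  obtain ⟨κ, _, c, hc⟩ := exists_coloring hA
  by_contra hinf
  have hk : ∀ k : ℕ, ∃ a, ((D \ derivedSet D) ∩ basic a).encard = k := fun k => by
    obtain ⟨Z, hZ, hZfin, hZk⟩ := Set.Infinite.exists_subset_ncard_eq hinf k
    have hO : Z ⊆ (closure (D \ Z))ᶜ := fun z hz hz' => by
      rw [closure_eq_self_union_derivedSet] at hz'
      rcases hz' with hz' | hz'
      · exact hz'.2 hz
      · exact (hZ hz).2 (derivedSet_mono _ _ Set.sdiff_subset hz')
    obtain ⟨V, h₁, h₂, h₃, h₄⟩ := exists_compact_open_between isTopologicalBasis_compactOpen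
      hZfin.isCompact isClosed_closure.isOpen_compl hO
    obtain ⟨a, rfl⟩ := exists_eq_basic h₁ h₂
    refine ⟨a, ?_⟩
    have : (D \ derivedSet D) ∩ basic a = Z := by
      refine Set.Subset.antisymm (fun x hx => ?_) fun x hx => ⟨hZ hx, h₃ hx⟩
      by_contra hn
      exact h₄ hx.2 (subset_closure ⟨hx.1.1, hn⟩)
    rw [this, ← hZk, hZfin.cast_ncard_eq]
  choose a ha using hk
  obtain ⟨k, m, hkm, hc'⟩ := Finite.exists_ne_map_eq_of_infinite fun k => c (a k)
  obtain ⟨φ, hφ, hφa⟩ := hc _ _ hc'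
  have hD' := preimage_congr_of_mem_stoneAlg φ hφ hD
  have : StoneSpace.congr φ ⁻¹' ((D \ derivedSet D) ∩ basic (a k)) =
      (D \ derivedSet D) ∩ basic (a m) := by
    rw [Set.preimage_inter, Set.preimage_sdiff, ← derivedSet_preimage_homeomorph, hD', ← hφa]
    rfl
  refine hkm (ENat.natCast_inj.1 ?_)
  rw [← ha k, ← ha m, ← this, ← (StoneSpace.congr φ).injective.encard_image (_ ⁻¹' _),
    Set.image_preimage_eq _ (StoneSpace.congr φ).surjective]

end Automorphisms

/-- A map to subsets with finitely many values factors through a finite poset, in any universe,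
which carries the reverse of the inclusion order. -/
theorem exists_poset_quotient {X : Type*} {Y : Type*} (ρ : X → Set Y) (hρ : (Set.range ρ).Finite) :
    ∃ (S : Type v) (_ : PartialOrder S) (_ : Finite S) (π : X → S), Function.Surjective π ∧
      ∀ x y, π x ≤ π y ↔ ρ y ⊆ ρ x := by
  have : Finite (Set.range ρ) := hρ
  obtain ⟨m, ⟨f⟩⟩ := Finite.exists_equiv_fin (Set.range ρ)
  let f' : Set.range ρ ≃ ULift.{v} (Fin m) := f.trans Equiv.ulift.symm
  let e : ULift.{v} (Fin m) → (Set Y)ᵒᵈ := fun s => OrderDual.toDual (f'.symm s).1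
  have he : Function.Injective e := fun s t hst => by
    have : (f'.symm s).1 = (f'.symm t).1 := hst
    exact f'.symm.injective (Subtype.ext this)
  let inst : PartialOrder (ULift.{v} (Fin m)) := PartialOrder.lift e he
  refine ⟨ULift.{v} (Fin m), inst, inferInstance, fun x => f' ⟨ρ x, x, rfl⟩, fun s => ?_,
    fun x y => ?_⟩
  · obtain ⟨x, hx⟩ := (f'.symm s).2
    refine ⟨x, ?_⟩
    rw [← f'.apply_symm_apply s]
    exact congrArg f' (Subtype.ext hx)
  · change (f'.symm (f' ⟨ρ y, y, rfl⟩)).1 ⊆ (f'.symm (f' ⟨ρ x, x, rfl⟩)).1 ↔ _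
    rw [f'.symm_apply_apply, f'.symm_apply_apply]

/-- The strata of an `ω`-categorical system are the sets of points which lie in the same closed
members of the closure algebra. -/
theorem OmegaCategorical.exists_isStratifiedBy {n : ℕ} {A : IdealSystem.{u} n}
    (hA : OmegaCategorical (idealLang n) A.carrier) :
    ∃ (T : PosetTuple.{v} n) (π : StoneSpace A.carrier → T.S), IsStratifiedBy A T π := by
  classical
  let 𝒞 : Set (Set (StoneSpace A.carrier)) := {C | C ∈ A.stoneAlg ∧ IsClosed C}
  have h𝒞 : 𝒞.Finite := finite_closed_stoneAlg hA
  have hcl : ∀ D ∈ A.stoneAlg, closure D ∈ 𝒞 := fun D hD => ⟨cl_mem_closureAlg hD, isClosed_closure⟩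
  let ρ : StoneSpace A.carrier → Set (Set (StoneSpace A.carrier)) := fun x => {C ∈ 𝒞 | x ∈ C}
  have hρ : (Set.range ρ).Finite := h𝒞.finite_subsets.subset (by
    rintro _ ⟨x, rfl⟩
    exact Set.sep_subset _ _)
  obtain ⟨S, _, _, π, hsurj, hle⟩ := exists_poset_quotient.{v} ρ hρ
  have heq : ∀ x y, π x = π y ↔ ρ x = ρ y := fun x y => by
    rw [le_antisymm_iff, hle, hle, subset_antisymm_iff, and_comm]
  have hfib : ∀ s, π ⁻¹' {s} ∈ A.stoneAlg := fun s => by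
    obtain ⟨x, rfl⟩ := hsurj s
    have : π ⁻¹' {π x} = ⋂ C ∈ 𝒞, if x ∈ C then C else Cᶜ := by
      ext y
      rw [Set.mem_preimage, Set.mem_singleton_iff, heq, Set.mem_iInter₂]
      constructor
      · intro h C hC
        have := Set.ext_iff.1 h C
        simp only [ρ, Set.mem_ofPred_eq, hC, true_and] at this
        split_ifs with hx
        · exact this.2 hx
        · exact fun hy => hx (this.1 hy)
      · intro h
        refine Set.ext fun C => and_congr_right fun hC => ?_
        have := h C hC
        split_ifs at this with hx
        · exact iff_of_true this hx
        · exact iff_of_false this hx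
    rw [this]
    refine biInter_mem_closureAlg h𝒞 fun C hC => ?_
    split_ifs
    · exact hC.1
    · exact BooleanSubalgebra.compl_mem hC.1
  have hclos : ∀ s, closure (π ⁻¹' {s}) = π ⁻¹' Set.Iic s := fun s => by
    obtain ⟨x, rfl⟩ := hsurj s
    ext y
    rw [Set.mem_preimage, Set.mem_Iic, hle]
    constructor
    · rintro hy C ⟨hC, hxC⟩
      refine ⟨hC, closure_minimal (fun z hz => ?_) hC.2 hy⟩
      have : C ∈ ρ z := ((heq z x).1 hz).symm ▸ (⟨hC, hxC⟩ : C ∈ ρ x)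
      exact this.2
    · intro h
      exact (h ⟨hcl _ (hfib (π x)), subset_closure rfl⟩).2
  have hzl : ∀ i, zeroLocus (A.J i) ∈ 𝒞 := fun i =>
    ⟨mem_closureAlg_of_mem ⟨i, rfl⟩, isClosed_zeroLocus _⟩
  have hne : ∀ s, (π ⁻¹' {s}).Nonempty := fun s => by
    obtain ⟨x, hx⟩ := hsurj s
    exact ⟨x, hx⟩
  let Q : Fin n → Set S := fun i => π '' zeroLocus (A.J i)
  have hQ' : ∀ i x, π x ∈ Q i ↔ x ∈ zeroLocus (A.J i) := fun i x => by
    refine ⟨?_, fun hx => ⟨x, hx, rfl⟩⟩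
    rintro ⟨y, hy, hyx⟩
    have : zeroLocus (A.J i) ∈ ρ x := (heq y x).1 hyx ▸ (⟨hzl i, hy⟩ : zeroLocus (A.J i) ∈ ρ y)
    exact this.2
  have hQ : ∀ i, zeroLocus (A.J i) = π ⁻¹' Q i := fun i => Set.ext fun x => (hQ' i x).symm
  have hgen : ∀ D ∈ A.stoneAlg,
      ∃ B ∈ closureAlg (fun s => (lowerClosure s : Set S)) (Set.range Q), D = π ⁻¹' B :=
    fun D hD => exists_eq_preimage_of_mem_closureAlg (by
      rintro _ ⟨i, rfl⟩
      exact ⟨Q i, ⟨i, rfl⟩, hQ i⟩) (closure_preimage_of_closure_fiber hclos) hD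
  have hcompact : ∀ s, (π ⁻¹' {s}).Finite → closure (π ⁻¹' {s}) = π ⁻¹' {s} := fun s hs =>
    hs.isClosed.closure_eq
  let T : PosetTuple.{v} n :=
    { S := S
      M := {s | IsCompact (closure (π ⁻¹' {s}))}
      F := {s | (π ⁻¹' {s}).Finite}
      g := fun s => (π ⁻¹' {s} \ derivedSet (π ⁻¹' {s})).encard.toNat
      Q := Q
      lower_M := fun s t hts hs => by
        refine IsCompact.of_isClosed_subset hs isClosed_closure ?_
        rw [hclos, hclos]
        exact Set.preimage_mono (Set.Iic_subset_Iic.2 hts)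
      lower_Q := fun i s t hts hs => by
        obtain ⟨x, rfl⟩ := hsurj s
        obtain ⟨y, rfl⟩ := hsurj t
        exact (hQ' i y).2 ((hle y x).1 hts ⟨hzl i, (hQ' i x).1 hs⟩).2
      F_sub := fun s hs => by
        refine ⟨?_, fun t _ hts => ?_⟩
        · change IsCompact (closure (π ⁻¹' {s}))
          rw [hcompact s hs]
          exact hs.isCompact
        · obtain ⟨x, hx⟩ := hne t
          have hx' : x ∈ closure (π ⁻¹' {s}) := by
            rw [hclos]
            exact (show π x = t from hx).trans_le hts
          rw [hcompact s hs] at hx'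
          exact ((show π x = s from hx').symm.trans hx).le
      g_pos := fun s hs => by
        rw [derivedSet_eq_empty_of_finite hs, Set.sdiff_empty, Nat.pos_iff_ne_zero, ne_eq,
          ENat.toNat_eq_zero, not_or]
        exact ⟨(Set.encard_ne_zero.2 (hne s)), Set.encard_ne_top_iff.2 hs⟩
      generates := by
        refine BooleanSubalgebra.ext fun B => iff_of_true ?_ BooleanSubalgebra.mem_top
        have : B = ⋃ s ∈ B, {s} := by simp
        rw [this]
        refine biUnion_mem_closureAlg (Set.toFinite B) fun s _ => ?_
        obtain ⟨B', hB', h⟩ := hgen _ (hfib s)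
        rwa [hsurj.preimage_injective h] }
  exact ⟨T, π, ⟨hsurj, hclos, fun s => Iff.rfl, fun s => Iff.rfl, fun s =>
    (ENat.natCast_toNat (Set.encard_ne_top_iff.2
      (finite_isolated_of_mem_stoneAlg hA (hfib s)))).symm⟩, hQ⟩

/-! ### A stratified space with prescribed invariants -/

section Model

open Filter

variable {S : Type u} [PartialOrder S]

/-- The underlying set of a space stratified by `S` with invariants `M`, `F`, `g`. It is a disjoint
union of compact pieces, which are labelled by triples `(s, b, j)`. A point of such a piece consists
of a monotone sequence in `S` which starts at `s`, and of a sequence of bits; it will belong to the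
stratum of the eventual value of the monotone sequence. In a piece with `b = true` the bits are zero
as long as the monotone sequence has its initial value `s`, so that the piece has one isolated point
of the stratum `s`. There are `g s` such pieces for each `s`, and, unless `s ∈ F`, also pieces
`(s, false, j)`, namely one if `s ∈ M`, and infinitely many if `s ∉ M`. -/
def modelSet (M F : Set S) (g : S → ℕ) : Set ((S × Bool × ℕ) × (ℕ → S) × (ℕ → Bool)) :=
  {z | ((z.1.2.1 = true ∧ z.1.2.2 < g z.1.1) ∨
      (z.1.2.1 = false ∧ z.1.1 ∉ F ∧ (z.1.1 ∈ M → z.1.2.2 = 0))) ∧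
    Monotone z.2.1 ∧ z.2.1 0 = z.1.1 ∧
    (z.1.2.1 = true → ∀ i, z.2.1 i = z.1.1 → z.2.2 i = false)}

theorem exists_eventually_eq_of_monotone [Finite S] {x : ℕ → S} (hx : Monotone x) :
    ∃ s, ∀ᶠ m in atTop, x m = s := by
  obtain ⟨N, hN⟩ := WellFoundedGT.monotone_chain_condition ⟨x, hx⟩
  exact ⟨x N, eventually_atTop.2 ⟨N, fun m hm => (hN m hm).symm⟩⟩

theorem isClosed_setOf_of_discrete {X Y : Type*} [TopologicalSpace X] [TopologicalSpace Y]
    [DiscreteTopology Y] (P : Y → Prop) {f : X → Y} (hf : Continuous f) : IsClosed {x | P (f x)} :=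
  (isClosed_discrete {y | P y}).preimage hf

theorem isClosed_modelSet [TopologicalSpace S] [DiscreteTopology S] (M F : Set S) (g : S → ℕ) :
    IsClosed (modelSet M F g) := by
  refine (isClosed_setOf_of_discrete (fun l : S × Bool × ℕ => (l.2.1 = true ∧ l.2.2 < g l.1) ∨
    (l.2.1 = false ∧ l.1 ∉ F ∧ (l.1 ∈ M → l.2.2 = 0))) continuous_fst).inter
    (IsClosed.inter ?_ (IsClosed.inter ?_ ?_))
  · have : {z : (S × Bool × ℕ) × (ℕ → S) × (ℕ → Bool) | Monotone z.2.1} =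
        ⋂ (i) (j) (_ : i ≤ j), {z | z.2.1 i ≤ z.2.1 j} := by
      ext z
      simp [Monotone]
    refine (this ▸ isClosed_iInter fun i => isClosed_iInter fun j => isClosed_iInter fun _ => ?_ :)
    exact isClosed_setOf_of_discrete (fun p : S × S => p.1 ≤ p.2)
      (f := fun z : (S × Bool × ℕ) × (ℕ → S) × (ℕ → Bool) => (z.2.1 i, z.2.1 j)) (by fun_prop)
  · exact isClosed_setOf_of_discrete (fun p : S × S => p.1 = p.2)
      (f := fun z : (S × Bool × ℕ) × (ℕ → S) × (ℕ → Bool) => (z.2.1 0, z.1.1)) (by fun_prop)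
  · have : {z : (S × Bool × ℕ) × (ℕ → S) × (ℕ → Bool) |
        z.1.2.1 = true → ∀ i, z.2.1 i = z.1.1 → z.2.2 i = false} =
        ⋂ i, {z | z.1.2.1 = true → z.2.1 i = z.1.1 → z.2.2 i = false} := by
      ext z
      simp only [Set.mem_ofPred_eq, Set.mem_iInter]
      exact ⟨fun h i hb => h hb i, fun h hb i => h i hb⟩
    refine (this ▸ isClosed_iInter fun i => ?_ :)
    exact isClosed_setOf_of_discrete
      (fun p : Bool × S × S × Bool => p.1 = true → p.2.1 = p.2.2.1 → p.2.2.2 = false)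
      (f := fun z : (S × Bool × ℕ) × (ℕ → S) × (ℕ → Bool) => (z.1.2.1, z.2.1 i, z.1.1, z.2.2 i))
      (by fun_prop)

variable {M F : Set S} {g : S → ℕ}

theorem tendsto_modelSet [TopologicalSpace S] {w : ℕ → modelSet M F g} {z : modelSet M F g}
    (hl : ∀ N, (w N).1.1 = z.1.1) (hx : ∀ i, ∀ᶠ N in atTop, (w N).1.2.1 i = z.1.2.1 i)
    (hc : ∀ i, ∀ᶠ N in atTop, (w N).1.2.2 i = z.1.2.2 i) : Tendsto w atTop (𝓝 z) := by
  rw [tendsto_subtype_rng]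
  refine Tendsto.prodMk_nhds ?_ (Tendsto.prodMk_nhds (tendsto_pi_nhds.2 fun i => ?_)
    (tendsto_pi_nhds.2 fun i => ?_))
  · exact tendsto_const_nhds.congr fun N => (hl N).symm
  · exact tendsto_const_nhds.congr' ((hx i).mono fun N h => h.symm)
  · exact tendsto_const_nhds.congr' ((hc i).mono fun N h => h.symm)

/-- The eventual value of the monotone sequence of a point. -/
noncomputable def limitStratum [Finite S] (z : modelSet M F g) : S :=
  (exists_eventually_eq_of_monotone z.2.2.1).choose

variable [Finite S]

theorem eventually_eq_limitStratum (z : modelSet M F g) :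
    ∀ᶠ m in atTop, z.1.2.1 m = limitStratum z :=
  (exists_eventually_eq_of_monotone z.2.2.1).choose_spec

theorem limitStratum_eq {z : modelSet M F g} {s : S} (h : ∀ᶠ m in atTop, z.1.2.1 m = s) :
    limitStratum z = s := by
  obtain ⟨m, h₁, h₂⟩ := ((eventually_eq_limitStratum z).and h).exists
  exact h₁.symm.trans h₂

theorem le_limitStratum (z : modelSet M F g) (i : ℕ) : z.1.2.1 i ≤ limitStratum z := by
  obtain ⟨m, h₁, h₂⟩ := ((eventually_eq_limitStratum z).and (eventually_ge_atTop i)).exists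
  exact h₁ ▸ z.2.2.1 h₂

theorem label_le_limitStratum (z : modelSet M F g) : z.1.1.1 ≤ limitStratum z := by
  rw [← z.2.2.2.1]
  exact le_limitStratum z 0

/-- The point of the piece `(s, b, j)` whose sequences are constant. -/
def constPoint (s : S) (b : Bool) (j : ℕ) (h : (b = true ∧ j < g s) ∨
    (b = false ∧ s ∉ F ∧ (s ∈ M → j = 0))) : modelSet M F g :=
  ⟨((s, b, j), fun _ => s, fun _ => false), h, monotone_const, rfl, fun _ _ _ => rfl⟩

theorem limitStratum_constPoint (s : S) (b : Bool) (j : ℕ) (h : (b = true ∧ j < g s) ∨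
    (b = false ∧ s ∉ F ∧ (s ∈ M → j = 0))) :
    limitStratum (constPoint s b j h : modelSet M F g) = s :=
  limitStratum_eq (Eventually.of_forall fun _ => rfl)

theorem surjective_limitStratum (hF : ∀ s ∈ F, 0 < g s) :
    Function.Surjective (limitStratum : modelSet M F g → S) := fun s => by
  by_cases hs : s ∈ F
  · exact ⟨constPoint s true 0 (Or.inl ⟨rfl, hF s hs⟩), limitStratum_constPoint ..⟩
  · exact ⟨constPoint s false 0 (Or.inr ⟨rfl, hs, fun _ => rfl⟩), limitStratum_constPoint ..⟩

/-- In a piece `(s, true, j)` there is only one point of the stratum `s`. -/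
theorem eq_constPoint {z : modelSet M F g} {s : S} (hz : limitStratum z = s)
    (hb : z.1.1.2.1 = true) (hs : z.1.1.1 = s) (h) : z = constPoint s true z.1.1.2.2 h := by
  have hx : ∀ i, z.1.2.1 i = s := fun i => le_antisymm (hz ▸ le_limitStratum z i) (by
    rw [← hs, ← z.2.2.2.1]
    exact z.2.2.1 (Nat.zero_le i))
  refine Subtype.ext (Prod.ext (Prod.ext hs (Prod.ext hb rfl)) (Prod.ext (funext hx) ?_))
  exact funext fun i => z.2.2.2.2 hb i ((hx i).trans hs.symm)

variable [TopologicalSpace S]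

/-- All other points of a stratum are accumulation points of it. -/
theorem mem_derivedSet_limitStratum_fiber {z : modelSet M F g} {s : S} (hz : limitStratum z = s)
    (h : ¬(z.1.1.2.1 = true ∧ z.1.1.1 = s)) :
    z ∈ derivedSet (limitStratum ⁻¹' {s} : Set (modelSet M F g)) := by
  obtain ⟨N₀, hN₀⟩ := eventually_atTop.1 (eventually_eq_limitStratum z)
  -- change a single bit, at an index where the monotone sequence is already constant
  let w : ℕ → modelSet M F g := fun N => ⟨(z.1.1, z.1.2.1,
    Function.update z.1.2.2 (N₀ + N) (!z.1.2.2 (N₀ + N))), z.2.1, z.2.2.1, z.2.2.2.1, by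
      intro hb i hi
      dsimp only at hi ⊢
      rw [Function.update_of_ne]
      · exact z.2.2.2.2 hb i hi
      · rintro rfl
        rw [hN₀ _ (Nat.le_add_right _ _), hz] at hi
        exact h ⟨hb, hi.symm⟩⟩
  have hw : Tendsto w atTop (𝓝 z) := by
    refine tendsto_modelSet (fun _ => rfl) (fun i => Eventually.of_forall fun _ => rfl) fun i => ?_
    filter_upwards [eventually_gt_atTop i] with N hN
    exact Function.update_of_ne (by omega) _ _
  refine accPt_iff_frequently.2 (hw.frequently (Eventually.of_forall fun N => ⟨?_, ?_⟩).frequently)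
  · intro hwz
    have := congrArg (fun y : modelSet M F g => y.1.2.2 (N₀ + N)) hwz
    simp [w] at this
  · exact limitStratum_eq ((eventually_eq_limitStratum z).mono fun m hm => hm.trans hz)

variable [DiscreteTopology S]

theorem closure_limitStratum_fiber (s : S) :
    closure (limitStratum ⁻¹' {s}) = (limitStratum ⁻¹' Set.Iic s : Set (modelSet M F g)) := by
  refine Set.Subset.antisymm (fun z hz => ?_) fun z hz => ?_
  · obtain ⟨N, hN⟩ := (eventually_eq_limitStratum z).exists
    have hopen : IsOpen {y : modelSet M F g | y.1.2.1 N = limitStratum z} :=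
      (isOpen_discrete {limitStratum z}).preimage
        (f := fun y : modelSet M F g => y.1.2.1 N) (by fun_prop)
    obtain ⟨y, hy, hys⟩ := mem_closure_iff.1 hz _ hopen hN
    exact (hy : y.1.2.1 N = _).symm.trans_le ((le_limitStratum y N).trans_eq hys)
  · replace hz : limitStratum z ≤ s := hz
    -- follow `z` up to the index `N`, and jump to `s` afterwards
    let w : ℕ → modelSet M F g := fun N => ⟨(z.1.1, fun i => if i ≤ N then z.1.2.1 i else s,
      fun i => if i ≤ N then z.1.2.2 i else false), z.2.1, by
        intro i j hij
        dsimp only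
        split_ifs with h₁ h₂ h₂
        · exact z.2.2.1 hij
        · exact (le_limitStratum z i).trans hz
        · exact absurd (hij.trans h₂) h₁
        · exact le_rfl, by simpa using z.2.2.2.1, by
        intro hb i hi
        dsimp only at hi ⊢
        split_ifs with h
        · rw [if_pos h] at hi
          exact z.2.2.2.2 hb i hi
        · rfl⟩
    refine mem_closure_of_tendsto (f := w) (b := atTop) ?_ (Eventually.of_forall fun N => ?_)
    · refine tendsto_modelSet (fun _ => rfl) (fun i => ?_) (fun i => ?_) <;>
      · filter_upwards [eventually_ge_atTop i] with N hN
        exact if_pos hN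
    · refine limitStratum_eq ?_
      filter_upwards [eventually_gt_atTop N] with m hm
      exact if_neg hm.not_ge

theorem constPoint_notMem_derivedSet (s : S) (j : ℕ) (h) :
    (constPoint s true j h : modelSet M F g) ∉ derivedSet (limitStratum ⁻¹' {s}) := fun hd => by
  have hopen : IsOpen {y : modelSet M F g | y.1.1 = (s, true, j)} :=
    (isOpen_discrete {(s, true, j)}).preimage
      (f := fun y : modelSet M F g => y.1.1) (by fun_prop)
  obtain ⟨y, ⟨hy, hys⟩, hne⟩ := accPt_iff_nhds.1 hd _ (hopen.mem_nhds rfl)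
  replace hy : y.1.1 = (s, true, j) := hy
  refine hne ((eq_constPoint (h := ?_) hys (by rw [hy]) (by rw [hy])).trans ?_)
  · rw [hy]
    exact h
  · simp only [hy]

theorem limitStratum_fiber_sdiff_derivedSet (s : S) :
    (limitStratum ⁻¹' {s} \ derivedSet (limitStratum ⁻¹' {s}) : Set (modelSet M F g)) =
      Set.range fun j : Fin (g s) => constPoint s true j (Or.inl ⟨rfl, j.2⟩) := by
  ext z
  constructor
  · rintro ⟨hz, hd⟩
    by_cases h : z.1.1.2.1 = true ∧ z.1.1.1 = s
    · have hj : z.1.1.2.2 < g s := by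
        rcases z.2.1 with h' | h'
        · exact h.2 ▸ h'.2
        · exact absurd (h.1.symm.trans h'.1) (by decide)
      exact ⟨⟨_, hj⟩, (eq_constPoint hz h.1 h.2 _).symm⟩
    · exact absurd (mem_derivedSet_limitStratum_fiber hz h) hd
  · rintro ⟨j, rfl⟩
    exact ⟨limitStratum_constPoint .., constPoint_notMem_derivedSet s j _⟩

theorem encard_limitStratum_fiber_sdiff_derivedSet (s : S) :
    (limitStratum ⁻¹' {s} \ derivedSet (limitStratum ⁻¹' {s}) :
      Set (modelSet M F g)).encard = g s := by
  have hinj : Function.Injective fun j : Fin (g s) =>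
      (constPoint s true j (Or.inl ⟨rfl, j.2⟩) : modelSet M F g) := fun i j hij =>
    Fin.ext (congrArg (fun y : modelSet M F g => y.1.1.2.2) hij)
  rw [limitStratum_fiber_sdiff_derivedSet, ← Set.image_univ, hinj.encard_image, Set.encard_univ]
  simp

theorem finite_limitStratum_fiber_iff (hM : IsLowerSet M) (hF : F ⊆ {s | Minimal (· ∈ M) s})
    (s : S) : s ∈ F ↔ (limitStratum ⁻¹' {s} : Set (modelSet M F g)).Finite := by
  constructor
  · intro hs
    refine (Set.finite_range fun j : Fin (g s) =>
      (constPoint s true j (Or.inl ⟨rfl, j.2⟩) : modelSet M F g)).subset fun z hz => ?_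
    rw [← limitStratum_fiber_sdiff_derivedSet]
    refine ⟨hz, fun hd => ?_⟩
    have hle : z.1.1.1 ≤ s := (label_le_limitStratum z).trans_eq hz
    have hsM : s ∈ M := (hF hs).1
    -- `s` is minimal, so that the piece of `z` has label `s`
    have hl : z.1.1.1 = s := hle.antisymm ((hF hs).2 (hM hle hsM) hle)
    rcases z.2.1 with ⟨hb, hj⟩ | ⟨-, hn, -⟩
    · have h : (true = true ∧ z.1.1.2.2 < g s) ∨
          (true = false ∧ s ∉ F ∧ (s ∈ M → z.1.1.2.2 = 0)) := Or.inl ⟨rfl, hl ▸ hj⟩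
      rw [eq_constPoint hz hb hl h] at hd
      exact constPoint_notMem_derivedSet _ _ _ hd
    · exact hn (hl ▸ hs)
  · intro hfin
    by_contra hs
    have h := mem_derivedSet_limitStratum_fiber (M := M) (F := F) (g := g)
      (limitStratum_constPoint s false 0 (Or.inr ⟨rfl, hs, fun _ => rfl⟩)) (by simp [constPoint])
    rw [derivedSet_eq_empty_of_finite hfin] at h
    exact h

theorem isCompact_closure_limitStratum_fiber_iff (hM : IsLowerSet M)
    (hF : F ⊆ {s | Minimal (· ∈ M) s}) (s : S) :
    s ∈ M ↔ IsCompact (closure (limitStratum ⁻¹' {s} : Set (modelSet M F g))) := by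
  constructor
  · intro hs
    obtain ⟨k, hk⟩ := (Set.finite_range g).bddAbove
    have hcomp : IsCompact {z : modelSet M F g | z.1.1.2.2 ≤ k} := by
      have hc : IsCompact ((Set.univ ×ˢ (Set.univ ×ˢ Set.Iic k)) ×ˢ Set.univ :
          Set ((S × Bool × ℕ) × (ℕ → S) × (ℕ → Bool))) :=
        (isCompact_univ.prod (isCompact_univ.prod (Set.finite_Iic k).isCompact)).prod isCompact_univ
      have := (isClosed_modelSet M F g).isClosedEmbedding_subtypeVal.isCompact_preimage hc
      convert this using 1
      ext z
      simp
    refine hcomp.of_isClosed_subset isClosed_closure fun z hz => ?_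
    rw [closure_limitStratum_fiber] at hz
    have hlM : z.1.1.1 ∈ M := hM ((label_le_limitStratum z).trans hz) hs
    rcases z.2.1 with ⟨-, hj⟩ | ⟨-, -, hj⟩
    · exact hj.le.trans (hk ⟨_, rfl⟩)
    · exact (hj hlM).le.trans (Nat.zero_le k)
  · intro hc
    by_contra hs
    have hsF : s ∉ F := fun h => hs (hF h).1
    have hfin := (hc.image (f := fun y : modelSet M F g => y.1.1.2.2) (by
      fun_prop)).finite_of_discrete
    refine Set.infinite_univ (hfin.subset fun j _ => ?_)
    exact ⟨constPoint s false j (Or.inr ⟨rfl, hsF, fun h => absurd h hs⟩),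
      subset_closure (limitStratum_constPoint ..), rfl⟩

theorem isStratification_limitStratum (hM : IsLowerSet M) (hF : F ⊆ {s | Minimal (· ∈ M) s})
    (hg : ∀ s ∈ F, 0 < g s) :
    IsStratification M F g (limitStratum : modelSet M F g → S) where
  surjective := surjective_limitStratum hg
  closure_fiber := closure_limitStratum_fiber
  mem_M := isCompact_closure_limitStratum_fiber_iff hM hF
  mem_F := finite_limitStratum_fiber_iff hM hF
  encard_isolated := encard_limitStratum_fiber_sdiff_derivedSet

theorem isTopologicalBasis_compactOpen_modelSet (M F : Set S) (g : S → ℕ) :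
    IsTopologicalBasis {U : Set (modelSet M F g) | IsCompact U ∧ IsOpen U} := by
  have : LocallyCompactSpace (modelSet M F g) :=
    (isClosed_modelSet M F g).isClosedEmbedding_subtypeVal.locallyCompactSpace
  refine isTopologicalBasis_of_isOpen_of_nhds (fun U hU => hU.2) fun z V hz hV => ?_
  obtain ⟨K, hKz, hKV, hK⟩ := local_compact_nhds (hV.mem_nhds hz)
  obtain ⟨U, hU, hzU, hUK⟩ := (loc_compact_Haus_tot_disc_of_zero_dim
    (H := modelSet M F g)).mem_nhds_iff.1 hKz
  exact ⟨U, ⟨hK.of_isClosed_subset hU.1 hUK, hU.2⟩, hzU, hUK.trans hKV⟩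

end Model

/-- Every tuple of invariants is realised by a stratification of a suitable space. -/
theorem exists_isStratification {S : Type v} [PartialOrder S] [Finite S] {M F : Set S} {g : S → ℕ}
    (hM : IsLowerSet M) (hF : F ⊆ {s | Minimal (· ∈ M) s}) (hg : ∀ s ∈ F, 0 < g s) :
    ∃ (X : Type u) (_ : TopologicalSpace X) (_ : T2Space X) (_ : SecondCountableTopology X)
      (π : X → S), IsTopologicalBasis {U : Set X | IsCompact U ∧ IsOpen U} ∧
        IsStratification M F g π := by
  -- a copy of `S` in the universe of the space
  obtain ⟨S', ⟨e⟩⟩ : ∃ S' : Type u, Nonempty (S' ≃ S) := by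
    obtain ⟨m, ⟨e⟩⟩ := Finite.exists_equiv_fin S
    exact ⟨ULift.{u} (Fin m), ⟨Equiv.ulift.trans e.symm⟩⟩
  have : Finite S' := Finite.of_equiv S e.symm
  let _ : PartialOrder S' := PartialOrder.lift e e.injective
  let θ : S' ≃o S := { e with map_rel_iff' := Iff.rfl }
  let _ : TopologicalSpace S' := ⊥
  have : DiscreteTopology S' := ⟨rfl⟩
  have hF' : θ ⁻¹' F ⊆ {s | Minimal (· ∈ θ ⁻¹' M) s} := fun s hs =>
    ⟨(hF hs).1, fun t ht hts => (hF hs).2 ht hts⟩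
  refine ⟨modelSet (θ ⁻¹' M) (θ ⁻¹' F) (g ∘ θ), inferInstance, inferInstance, inferInstance,
    θ ∘ limitStratum, isTopologicalBasis_compactOpen_modelSet _ _ _, ?_⟩
  have h := isStratification_limitStratum (M := θ ⁻¹' M) (F := θ ⁻¹' F) (g := g ∘ θ)
    (fun s t hst hs => hM (θ.monotone hst) hs) hF' fun s hs => hg _ hs
  exact h.comp_orderIso θ (fun _ => Iff.rfl) (fun _ => Iff.rfl) fun _ => rfl

/-! ### The Boolean ring of compact open sets -/

theorem zmod_two_eq_zero_or_one (a : ZMod 2) : a = 0 ∨ a = 1 := by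
  revert a
  decide

theorem isCompact_isOpen_sdiff {X : Type*} [TopologicalSpace X] [T2Space X] {U V : Set X}
    (hU : IsCompact U ∧ IsOpen U) (hV : IsCompact V ∧ IsOpen V) :
    IsCompact (U \ V) ∧ IsOpen (U \ V) :=
  ⟨hU.1.diff hV.2, hU.2.sdiff hV.1.isClosed⟩

/-- The ring of compact open subsets of a Hausdorff space, in the form of their indicator functions
with values in the two-element field. -/
def compactOpenRing (X : Type*) [TopologicalSpace X] [T2Space X] :
    NonUnitalSubring (X → ZMod 2) where
  carrier := {f | IsCompact {x | f x = 1} ∧ IsOpen {x | f x = 1}}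
  zero_mem' := by simp
  add_mem' {f g} hf hg := by
    have h : {x | (f + g) x = 1} = ({x | f x = 1} \ {x | g x = 1}) ∪
        ({x | g x = 1} \ {x | f x = 1}) := by
      ext x
      have h2 : (1 : ZMod 2) + 1 = 0 := rfl
      rcases zmod_two_eq_zero_or_one (f x) with h | h <;>
        rcases zmod_two_eq_zero_or_one (g x) with k | k <;> simp [h, k, h2]
    have h₁ := isCompact_isOpen_sdiff hf hg
    have h₂ := isCompact_isOpen_sdiff hg hf
    change IsCompact {x | (f + g) x = 1} ∧ IsOpen {x | (f + g) x = 1}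
    rw [h]
    exact ⟨h₁.1.union h₂.1, h₁.2.union h₂.2⟩
  mul_mem' {f g} hf hg := by
    have h : {x | (f * g) x = 1} = {x | f x = 1} ∩ {x | g x = 1} := by
      ext x
      rcases zmod_two_eq_zero_or_one (f x) with h | h <;>
        rcases zmod_two_eq_zero_or_one (g x) with k | k <;> simp [h, k]
    change IsCompact {x | (f * g) x = 1} ∧ IsOpen {x | (f * g) x = 1}
    rw [h]
    exact ⟨hf.1.inter hg.1, hf.2.inter hg.2⟩
  neg_mem' {f} hf := by
    have h : -f = f := funext fun x => ZMod.neg_eq_self_mod_two (f x)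
    rwa [h]

section

variable {X : Type u} [TopologicalSpace X] [T2Space X]

theorem exists_mem_compactOpenRing {U : Set X} (hU : IsCompact U) (hUo : IsOpen U) :
    ∃ f : compactOpenRing X, ∀ x, f.1 x = 1 ↔ x ∈ U := by
  classical
  have h : ∀ x, (if x ∈ U then 1 else 0 : ZMod 2) = 1 ↔ x ∈ U := fun x => by
    split_ifs with h <;> simp [h]
  refine ⟨⟨fun x => if x ∈ U then 1 else 0, ?_⟩, h⟩
  change IsCompact {x | (if x ∈ U then 1 else 0 : ZMod 2) = 1} ∧ IsOpen _
  simp only [h]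
  exact ⟨hU, hUo⟩

theorem compactOpenRing_idem (f : compactOpenRing X) : f * f = f := by
  refine Subtype.ext (funext fun x => ?_)
  change f.1 x * f.1 x = f.1 x
  rcases zmod_two_eq_zero_or_one (f.1 x) with h | h <;> rw [h] <;> rfl

theorem compactOpenRing_ext {f g : compactOpenRing X} (h : ∀ x, f.1 x = 1 ↔ g.1 x = 1) :
    f = g := by
  refine Subtype.ext (funext fun x => ?_)
  have := h x
  rcases zmod_two_eq_zero_or_one (f.1 x) with h | h <;>
    rcases zmod_two_eq_zero_or_one (g.1 x) with k | k <;> simp_all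

theorem countable_compactOpenRing [SecondCountableTopology X] : Countable (compactOpenRing X) := by
  have hb := isBasis_countableBasis X
  have hfin : ∀ f : compactOpenRing X, ∃ s : Finset (countableBasis X),
      {x | f.1 x = 1} = ⋃ i ∈ s, (i : Set X) := fun f => by
    obtain ⟨s, hs, h⟩ := eq_finite_iUnion_of_isTopologicalBasis_of_isCompact_open
      (fun i : countableBasis X => (i : Set X)) (by simpa using hb) _ f.2.1 f.2.2
    exact ⟨hs.toFinset, by simpa using h⟩
  choose s hs using hfin
  have : Countable (countableBasis X) := (countable_countableBasis X).to_subtype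
  refine Function.Injective.countable (f := s) fun f g hfg => compactOpenRing_ext fun x => ?_
  have h : {x | f.1 x = 1} = {x | g.1 x = 1} := by rw [hs f, hs g, hfg]
  exact Set.ext_iff.1 h x

/-- Evaluation at `x`. -/
def evalHom (x : X) : compactOpenRing X →ₙ+* ZMod 2 where
  toFun f := f.1 x
  map_mul' _ _ := rfl
  map_zero' := rfl
  map_add' _ _ := rfl

/-- A homomorphism from the ring of compact open sets to the two-element field which is not zero is
the evaluation at a point: the compact open sets at which it takes the value `1` have a common
point. -/
theorem exists_eq_evalHom (φ : compactOpenRing X →ₙ+* ZMod 2) (hφ : φ ≠ 0) :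
    ∃ x, φ = evalHom x := by
  obtain ⟨f₀, hf₀⟩ : ∃ f, φ f = 1 := by
    by_contra hn
    refine hφ (NonUnitalRingHom.ext fun f => ?_)
    exact (zmod_two_eq_zero_or_one (φ f)).resolve_right fun h => hn ⟨f, h⟩
  have : Nonempty {f // φ f = 1} := ⟨⟨f₀, hf₀⟩⟩
  obtain ⟨x, hx⟩ := IsCompact.nonempty_iInter_of_directed_nonempty_isCompact_isClosed
    (fun f : {f // φ f = 1} => {x | f.1.1 x = 1}) (fun f g => by
      refine ⟨⟨f.1 * g.1, by rw [map_mul, f.2, g.2]; rfl⟩, fun x hx => ?_, fun x hx => ?_⟩ <;>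
      · have h : f.1.1 x * g.1.1 x = 1 := hx
        rcases zmod_two_eq_zero_or_one (f.1.1 x) with h₁ | h₁ <;>
          rcases zmod_two_eq_zero_or_one (g.1.1 x) with h₂ | h₂ <;> simp_all) (fun f => by
      by_contra hn
      have h0 : f.1 = 0 := compactOpenRing_ext fun x =>
        iff_of_false (fun h => hn ⟨x, h⟩) zero_ne_one
      have := f.2
      rw [h0, map_zero] at this
      exact zero_ne_one this) (fun f => f.1.2.1) fun f => f.1.2.1.isClosed
  have hx' : ∀ f, φ f = 1 → f.1 x = 1 := fun f hf => Set.mem_iInter.1 hx ⟨f, hf⟩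
  refine ⟨x, NonUnitalRingHom.ext fun f => ?_⟩
  change φ f = f.1 x
  rcases zmod_two_eq_zero_or_one (φ f) with hf | hf
  · -- `φ` takes the value `1` at the difference of `f₀` and `f`
    have h : f₀.1 x + f₀.1 x * f.1 x = 1 := hx' (f₀ + f₀ * f) (by
      rw [map_add, map_mul, hf, hf₀, mul_zero, add_zero])
    rw [hx' f₀ hf₀, one_mul] at h
    rw [hf]
    exact (add_eq_left.1 h).symm
  · rw [hf, hx' f hf]

/-- A Hausdorff space with a basis of compact open sets is the Stone space of its ring of compact
open sets. -/
theorem exists_homeomorph_stoneSpace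
    (hX : IsTopologicalBasis {U : Set X | IsCompact U ∧ IsOpen U}) :
    ∃ h : X ≃ₜ StoneSpace (compactOpenRing X), ∀ x, (h x).1 = evalHom x := by
  have hne : ∀ x : X, evalHom x ≠ 0 := fun x h0 => by
    obtain ⟨U, ⟨hU, hUo⟩, hxU, -⟩ := hX.exists_subset_of_mem_open (Set.mem_univ x) isOpen_univ
    obtain ⟨f, hf⟩ := exists_mem_compactOpenRing hU hUo
    have h : f.1 x = 0 := DFunLike.congr_fun h0 f
    rw [(hf x).2 hxU] at h
    exact one_ne_zero h
  let ev : X → StoneSpace (compactOpenRing X) := fun x => ⟨evalHom x, hne x⟩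
  have hsurj : Function.Surjective ev := fun y => by
    obtain ⟨x, hx⟩ := exists_eq_evalHom y.1 y.2
    exact ⟨x, Subtype.ext hx.symm⟩
  have hinj : Function.Injective ev := fun x y hxy => by
    by_contra hne
    obtain ⟨U, ⟨hU, hUo⟩, hxU, hUy⟩ := hX.exists_subset_of_mem_open (u := {y}ᶜ) hne
      isOpen_compl_singleton
    obtain ⟨f, hf⟩ := exists_mem_compactOpenRing hU hUo
    have h : f.1 x = f.1 y := DFunLike.congr_fun (congrArg Subtype.val hxy) f
    exact hUy ((hf y).1 (h ▸ (hf x).2 hxU)) rfl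
  have hcont : Continuous ev := continuous_generateFrom_iff.2 (by
    rintro _ ⟨f, rfl⟩
    exact f.2.2)
  have hopen : IsOpenMap ev := hX.isOpenMap_iff.2 fun U hU => by
    obtain ⟨f, hf⟩ := exists_mem_compactOpenRing hU.1 hU.2
    have h : ev '' U = basic f := by
      ext y
      obtain ⟨x, rfl⟩ := hsurj y
      rw [hinj.mem_set_image]
      exact (hf x).symm
    rw [h]
    exact isOpen_basic f
  exact ⟨(Equiv.ofBijective ev ⟨hinj, hsurj⟩).toHomeomorphOfContinuousOpen hcont hopen,
    fun x => rfl⟩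

/-- The ideal of the compact open sets that are disjoint from `C`. -/
def vanishingIdeal (C : Set X) : TwoSidedIdeal (compactOpenRing X) :=
  TwoSidedIdeal.mk' {f | ∀ x ∈ C, f.1 x = 0} (fun _ _ => rfl)
    (fun {f g} hf hg x hx => by
      change f.1 x + g.1 x = 0
      rw [hf x hx, hg x hx, add_zero])
    (fun {f} hf x hx => by
      change -f.1 x = 0
      rw [hf x hx, neg_zero])
    (fun {f g} hg x hx => by
      change f.1 x * g.1 x = 0
      rw [hg x hx, mul_zero])
    (fun {f g} hf x hx => by
      change f.1 x * g.1 x = 0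
      rw [hf x hx, zero_mul])

theorem mem_vanishingIdeal {C : Set X} {f : compactOpenRing X} :
    f ∈ vanishingIdeal C ↔ ∀ x ∈ C, f.1 x = 0 := TwoSidedIdeal.mem_mk' ..

theorem mem_zeroLocus_vanishingIdeal (hX : IsTopologicalBasis {U : Set X | IsCompact U ∧ IsOpen U})
    {C : Set X} (hC : IsClosed C) {x : X} {y : StoneSpace (compactOpenRing X)}
    (hy : y.1 = evalHom x) : y ∈ zeroLocus (vanishingIdeal C) ↔ x ∈ C := by
  constructor
  · intro h
    by_contra hx
    obtain ⟨U, ⟨hU, hUo⟩, hxU, hUC⟩ := hX.exists_subset_of_mem_open (u := Cᶜ) hx hC.isOpen_compl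
    obtain ⟨f, hf⟩ := exists_mem_compactOpenRing hU hUo
    have h₁ : y.1 f = 0 := h f (mem_vanishingIdeal.2 fun z hz =>
      (zmod_two_eq_zero_or_one _).resolve_right fun h => hUC ((hf z).1 h) hz)
    rw [hy] at h₁
    exact one_ne_zero (((hf x).2 hxU).symm.trans h₁)
  · intro hx f hf
    rw [hy]
    exact mem_vanishingIdeal.1 hf x hx

end

/-- Every tuple is the tuple of a countable system. -/
theorem PosetTuple.exists_isStratifiedBy {n : ℕ} (T : PosetTuple.{v} n) :
    ∃ (A : IdealSystem.{u} n) (π : StoneSpace A.carrier → T.S),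
      Countable A.carrier ∧ IsStratifiedBy A T π := by
  obtain ⟨X, _, _, _, π, hX, hπ⟩ := exists_isStratification.{u} T.lower_M T.F_sub T.g_pos
  obtain ⟨h, hh⟩ := exists_homeomorph_stoneSpace hX
  have hclosed : ∀ i, IsClosed (π ⁻¹' T.Q i) := fun i => by
    rw [← closure_subset_iff_isClosed, closure_preimage_of_closure_fiber hπ.closure_fiber,
      (T.lower_Q i).lowerClosure]
  refine ⟨⟨compactOpenRing X, compactOpenRing_idem, fun i => vanishingIdeal (π ⁻¹' T.Q i)⟩,
    π ∘ h.symm, countable_compactOpenRing, hπ.comp_homeomorph _, fun i => ?_⟩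
  ext y
  exact mem_zeroLocus_vanishingIdeal hX (hclosed i) (by rw [← hh, h.apply_symm_apply])

/-! ### The bijection -/

theorem IsTupleOf.exists_isStratifiedBy {n : ℕ} {A : IdealSystem.{u} n} {T : PosetTuple.{v} n}
    (hA : OmegaCategorical (idealLang n) A.carrier) (h : IsTupleOf A T) :
    ∃ π : StoneSpace A.carrier → T.S, IsStratifiedBy A T π := by
  obtain ⟨T', π, hπ⟩ := OmegaCategorical.exists_isStratifiedBy.{u, v} hA
  exact hπ.of_iso_right (hπ.isTupleOf.iso h)

/-- A relation that respects two equivalence relations, and is a one-to-one correspondence up to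
them, is the graph of a bijection of the quotients. -/
theorem exists_quotient_equiv {α β : Type*} (sα : Setoid α) (sβ : Setoid β) (R : α → β → Prop)
    (left_total : ∀ a, ∃ b, R a b) (right_total : ∀ b, ∃ a, R a b)
    (congr_left : ∀ a a' b, sα a a' → R a b → R a' b)
    (congr_right : ∀ a b b', sβ b b' → R a b → R a b')
    (left_unique : ∀ a a' b, R a b → R a' b → sα a a')
    (right_unique : ∀ a b b', R a b → R a b' → sβ b b') :
    ∃ Φ : Quotient sα ≃ Quotient sβ, ∀ a b, Φ (Quotient.mk _ a) = Quotient.mk _ b ↔ R a b := by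
  choose f hf using left_total
  let Φ : Quotient sα → Quotient sβ := Quotient.lift (fun a => Quotient.mk sβ (f a))
    fun a a' h => Quotient.sound (right_unique _ _ _ (congr_left _ _ _ h (hf a)) (hf a'))
  have hΦ : ∀ a b, Φ (Quotient.mk _ a) = Quotient.mk _ b ↔ R a b := fun a b =>
    ⟨fun h => congr_right _ _ _ (Quotient.exact h) (hf a),
      fun h => Quotient.sound (right_unique _ _ _ (hf a) h)⟩
  refine ⟨Equiv.ofBijective Φ ⟨?_, ?_⟩, hΦ⟩
  · rintro ⟨a⟩ ⟨a'⟩ h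
    exact Quotient.sound (left_unique _ _ _ ((hΦ a (f a')).1 (h.trans ((hΦ a' (f a')).2 (hf a'))))
      (hf a'))
  · rintro ⟨b⟩
    obtain ⟨a, ha⟩ := right_total b
    exact ⟨Quotient.mk _ a, (hΦ a b).2 ha⟩

end BoolIdeals

/-- The map sending a system to the tuple of atoms of its closure algebra is a well-defined
bijection between isomorphism classes. -/
theorem theorem5p4 (n : ℕ) :
    ∃ Φ : Quotient (BoolIdeals.OmegaCatSystem.instSetoid.{u} n) ≃
        Quotient (BoolIdeals.PosetTuple.instSetoid.{v} n),
      ∀ (A : BoolIdeals.OmegaCatSystem.{u} n) (T : BoolIdeals.PosetTuple.{v} n),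
        Φ (Quotient.mk _ A) = Quotient.mk _ T ↔ BoolIdeals.IsTupleOf A.1 T := by
  refine BoolIdeals.exists_quotient_equiv _ _
    (fun (A : BoolIdeals.OmegaCatSystem.{u} n) (T : BoolIdeals.PosetTuple.{v} n) =>
      BoolIdeals.IsTupleOf A.1 T) (fun A => ?_) (fun T => ?_) (fun A A' T hA h => ?_)
    (fun A T T' hT h => ?_) (fun A A' T h h' => ?_) fun A T T' h h' => h.iso h'
  · obtain ⟨T, π, hπ⟩ := BoolIdeals.OmegaCategorical.exists_isStratifiedBy.{u, v} A.2
    exact ⟨T, hπ.isTupleOf⟩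
  · obtain ⟨A, π, _, hπ⟩ := T.exists_isStratifiedBy
    exact ⟨⟨A, hπ.omegaCategorical⟩, hπ.isTupleOf⟩
  · obtain ⟨π, hπ⟩ := h.exists_isStratifiedBy A.2
    obtain ⟨π', hπ'⟩ := hπ.of_iso_left hA
    exact hπ'.isTupleOf
  · obtain ⟨π, hπ⟩ := h.exists_isStratifiedBy A.2
    obtain ⟨π', hπ'⟩ := hπ.of_iso_right hT
    exact hπ'.isTupleOf
  · obtain ⟨π, hπ⟩ := h.exists_isStratifiedBy A.2
    obtain ⟨π', hπ'⟩ := h'.exists_isStratifiedBy A'.2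
    have := A.2.1
    have := A'.2.1
    exact hπ.iso hπ'
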